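/- Identify $\mathbb{R}^2$ with $\mathbb{C}$. Let $\mu$ be a probability measure with finite support on the group of orientation-preserving isometries of $\mathbb{R}^2$; such an isometry has the form $g(x)=e^{i\theta(g)}x+g(0)$, where $\theta(g)\in\mathbb{R}/2\pi\mathbb{Z}$ is its angle of rotation. Let $g_1,g_2,\dots$ be independent with law $\mu$ and put $Y_N=(g_1g_2\cdots g_N)(0)$. For $m>0$, say that an angle $\theta$ satisfies (D.C.-$m$) if there is $q_0$ such that $|\theta-2\pi p/q|\ge q^{-m}$ for all integers $p$ and all integers $q\ge q_0$. Suppose that $\mathbb{E}\,g_1(0)=0$ and that for some $m>0$ one of the following holds: 1. there are $h_1,h_2\in\operatorname{supp}\mu$ such that $\theta(h_1h_2^{-1})$ satisfies (D.C.-$m$); 2. there is $\theta_0$ satisfying (D.C.-$m$) such that $\theta(g)=\theta_0$ for all $g\in\operatorname{supp}\mu$. Then there is $c>0$ such that $Y_N$ satisfies a local central limit theorem to scale $e^{-c(\log N)^2}$, i.e. for each $N$ there is a Gaussian random variable $Z_N$ on $\mathbb{R}^2$ (possibly degenerate) such that $$|\mathbb{P}(Y_N\in B_r(x_0))-\mathbb{P}(Z_N\in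 B_r(x_0))|=o(N^{-1}r^2)\quad\text{as }N\to\infty,$$ uniformly in $x_0\in\mathbb{R}^2$ and $r>e^{-c(\log N)^2}$. More precisely, with $\sigma^2=\frac12\mathbb{E}|g_1(0)|^2$, $\sigma\ge0$, and $Z$ a standard Gaussian on $\mathbb{R}^2$, there is a constant $C>0$ such that for all integers $N\ge1$, all $x_0\in\mathbb{R}^2$ and all $r>e^{-c(\log N)^2}$, $$|\mathbb{P}(Y_N\in B_r(x_0))-\mathbb{P}(\sigma\sqrt N\,Z\in B_r(x_0))|\le C N^{-3/2}r^2.$$ -/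

import Mathlib

open MeasureTheory ProbabilityTheory Filter

/-- The isometry group of the plane `ℝ² = ℂ` carries the σ-algebra generated by the evaluations
`g ↦ g x`, i.e. the Borel σ-algebra of its usual topology (pointwise convergence). -/
noncomputable instance isomMeasurableSpace : MeasurableSpace (ℂ ≃ᵢ ℂ) :=
  MeasurableSpace.comap (fun (g : ℂ ≃ᵢ ℂ) (x : ℂ) => g x) MeasurableSpace.pi

/-- `g = τ_{g(0)} ∘ ρ_θ`: the isometry `g` is orientation preserving and `θ` is (a representative
modulo `2π` of) its angle of rotation `θ(g)`. -/
def HasRotationAngle (g : ℂ ≃ᵢ ℂ) (θ : ℝ) : Prop :=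
  ∀ x : ℂ, g x = Complex.exp (θ * Complex.I) * x + g 0

/-- The Diophantine condition with exponent `m`: `|θ - 2πp/q| ≥ q^{-m}` for all integers `p` and
all sufficiently large `q`. It is invariant under `θ ↦ θ + 2π`. -/
def DiophantineAngle (m θ : ℝ) : Prop :=
  ∃ q₀ : ℕ, ∀ q : ℕ, q₀ ≤ q → ∀ p : ℤ, (q : ℝ) ^ (-m) ≤ |θ - 2 * Real.pi * p / q|

/-- `Y_N = (g₁ g₂ ⋯ g_N)(0)`. -/
noncomputable def walkPoint (N : ℕ) (g : Fin N → (ℂ ≃ᵢ ℂ)) : ℂ :=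
  (List.ofFn g).prod 0

/-- `P(Y_N ∈ B)`, where `g₁, …, g_N` are independent with law `μ`. -/
noncomputable def walkProb (μ : PMF (ℂ ≃ᵢ ℂ)) (N : ℕ) (B : Set ℂ) : ℝ :=
  (Measure.pi fun _ : Fin N => μ.toMeasure).real {g | walkPoint N g ∈ B}

/-- `σ = (½ E|g₁(0)|²)^{1/2}`. -/
noncomputable def walkSigma (μ : PMF (ℂ ≃ᵢ ℂ)) : ℝ :=
  Real.sqrt ((1 / 2) * ∫ g, ‖g 0‖ ^ 2 ∂μ.toMeasure)

/-- The local central limit theorem to scale `δ_N`: there are Gaussian laws `γ_N` on the plane with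
`|P(Y_N ∈ B_r(x₀)) - γ_N(B_r(x₀))| = o(N⁻¹ r²)` uniformly in `x₀` and `r > δ_N`. -/
def LocalCLTToScale (μ : PMF (ℂ ≃ᵢ ℂ)) (δ : ℕ → ℝ) : Prop :=
  ∃ γ : ℕ → Measure ℂ, (∀ N, IsGaussian (γ N)) ∧
    ∀ ε : ℝ, 0 < ε → ∀ᶠ N : ℕ in atTop, ∀ (x₀ : ℂ) (r : ℝ), δ N < r →
      |walkProb μ N (Metric.ball x₀ r) - (γ N).real (Metric.ball x₀ r)| ≤ ε * ((N : ℝ)⁻¹ * r ^ 2)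

open scoped ComplexConjugate ENNReal

/-! ### Functions on the circle -/

/-! On the circle of radius R in frequency space, the characteristic function of Y_N is T_R^N 1,
where T_R (`avgOp`) averages over the steps the L² isometries F(x) ↦ e^{iR⟨b, e^{ix}⟩} F(x - θ); see
`charFun_walkLaw`. Everything rests on norm bounds for T_R^N, for R up to e^{c (log N)²}.

Spectral gap. If T_R^ℓ hardly shrinks F, the variance identity `sum_l2_twist_sub_sq` forces all
words of a given length n ≤ ℓ to act on F almost alike. The words g g' h and g' g h have the same
rotation, and their translations differ by a vector τ that does not depend on h; mean zero makes τ ≠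
0 for some pair (`exists_not_commute`). Letting the rotation of h run through γ + mα, and writing ω
= e^{iα}, one finds that the numbers Re(z ω^m), with |z| = R|τ|, lie close to 2πℤ on average against
|F|². For large R this alone is no contradiction. But k-fold differencing with step q replaces z by
z(ω^q - 1)^k. Once this has modulus at most π, being close to 2πℤ means being close to 0, and y and
yω cannot both have small real part relative to |y|, as ω is not real
(`rotating_sequence_lower_bound`, `spectral_gap`).

Dirichlet's theorem gives q of order at most y with |ω^q - 1| at most of order 1/y, and the
Diophantine condition bounds it below by a power of 1/y. So k is about log R / log y, and the loss
4^k is polynomial in y as long as log R is at most of order (log y)². Taking for y a small power of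
N produces the scale e^{-c (log N)²} (`GapData.exists_high_decay`).

Low frequencies. For bounded R the gap is of order R² (no differencing is needed), and 1 plus a
correction of size R² is an eigenfunction of T_R with eigenvalue e^{-σ²R²/2} up to O(R³)
(`exists_approx_eigenfunction`). Telescoping compares T_R^N 1 with the Gaussian
(`exists_low_approx`).

Conclusion. `GapData.exists_radial_bound` combines all frequencies, the highest being killed by the
decay of the Fourier transform of a smoothing kernel. Integration in polar coordinates gives
N^{-3/2}, and `exists_smoothing`, with smoothing width r/√N, passes to masses of balls. -/

instance fact_two_pi_pos : Fact (0 < 2 * Real.pi) := ⟨Real.two_pi_pos⟩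

/-- The circle `ℝ / 2πℤ`. -/
abbrev Ang : Type := AddCircle (2 * Real.pi)

/-- The point of the unit circle with angle `x`. -/
noncomputable def unitAt (x : Ang) : ℂ := (AddCircle.toCircle x : ℂ)

lemma norm_unitAt (x : Ang) : ‖unitAt x‖ = 1 := Circle.norm_coe _

lemma unitAt_add (x y : Ang) : unitAt (x + y) = unitAt x * unitAt y := by
  simp [unitAt, AddCircle.toCircle_add]

lemma unitAt_zero : unitAt 0 = 1 := by simp [unitAt]

lemma unitAt_neg (x : Ang) : unitAt (-x) = conj (unitAt x) := by
  rw [unitAt, AddCircle.toCircle_neg, Circle.coe_inv_eq_conj, unitAt]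

lemma unitAt_nsmul (n : ℕ) (x : Ang) : unitAt (n • x) = unitAt x ^ n := by
  simp [unitAt, AddCircle.toCircle_nsmul]

lemma unitAt_coe (x : ℝ) : unitAt (x : Ang) = Complex.exp (x * Complex.I) := by
  simp [unitAt, AddCircle.toCircle_apply_mk, Circle.coe_exp]

lemma continuous_unitAt : Continuous unitAt :=
  continuous_subtype_val.comp AddCircle.continuous_toCircle

/-- The character `x ↦ e^{ix}` of the real line. -/
noncomputable def phase (x : ℝ) : ℂ := Complex.exp (x * Complex.I)

lemma norm_phase (x : ℝ) : ‖phase x‖ = 1 := Complex.norm_exp_ofReal_mul_I x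

lemma phase_add (x y : ℝ) : phase (x + y) = phase x * phase y := by
  simp [phase, add_mul, Complex.exp_add]

lemma phase_zero : phase 0 = 1 := by simp [phase]

lemma continuous_phase : Continuous phase := by unfold phase; fun_prop

lemma inner_mul_unitAt (b : ℂ) (x y : Ang) :
    inner ℝ b (unitAt (x - y)) = inner ℝ (unitAt y * b) (unitAt x) := by
  rw [sub_eq_add_neg, unitAt_add, unitAt_neg, Complex.inner, Complex.inner, map_mul]
  congr 1; ring

/-- The action of the isometry with rotation angle `θ` and translation part `b` on functions on the
circle of radius `R` in frequency space. -/
noncomputable def twist (R : ℝ) (θ : Ang) (b : ℂ) : C(Ang, ℂ) →ₗ[ℂ] C(Ang, ℂ) where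
  toFun F := ⟨fun x => phase (R * inner ℝ b (unitAt x)) * F (x - θ), by
    have h1 := continuous_unitAt
    have h2 := continuous_phase
    fun_prop⟩
  map_add' F G := by ext x; simp [mul_add]
  map_smul' c F := by ext x; simp; ring

lemma twist_apply (R : ℝ) (θ : Ang) (b : ℂ) (F : C(Ang, ℂ)) (x : Ang) :
    twist R θ b F x = phase (R * inner ℝ b (unitAt x)) * F (x - θ) := rfl

lemma twist_zero (R : ℝ) (F : C(Ang, ℂ)) : twist R 0 0 F = F := by
  ext x; simp [twist_apply, phase_zero]

lemma twist_twist (R : ℝ) (θ θ' : Ang) (b b' : ℂ) (F : C(Ang, ℂ)) :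
    twist R θ b (twist R θ' b' F) = twist R (θ + θ') (b + unitAt θ * b') F := by
  ext x
  simp only [twist_apply, inner_mul_unitAt, inner_add_left, mul_add, phase_add, sub_sub, mul_assoc]

/-- The `L²` seminorm on continuous functions on the circle. -/
noncomputable def l2 (F : C(Ang, ℂ)) : ℝ :=
  ‖ContinuousMap.toLp (E := ℂ) 2 (volume : Measure Ang) ℂ F‖

lemma l2_nonneg (F : C(Ang, ℂ)) : 0 ≤ l2 F := norm_nonneg _

lemma l2_add_le (F G : C(Ang, ℂ)) : l2 (F + G) ≤ l2 F + l2 G := by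
  unfold l2; rw [map_add]; exact norm_add_le _ _

lemma l2_sub_le (F G : C(Ang, ℂ)) : l2 (F - G) ≤ l2 F + l2 G := by
  unfold l2; rw [map_sub]; exact norm_sub_le _ _

lemma l2_sub_le_sub_add_sub (F G H : C(Ang, ℂ)) : l2 (F - H) ≤ l2 (F - G) + l2 (G - H) := by
  rw [← sub_add_sub_cancel F G H]; exact l2_add_le _ _

lemma l2_sub_comm (F G : C(Ang, ℂ)) : l2 (F - G) = l2 (G - F) := by
  unfold l2; rw [map_sub, map_sub, norm_sub_rev]

lemma l2_smul (c : ℂ) (F : C(Ang, ℂ)) : l2 (c • F) = ‖c‖ * l2 F := by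
  unfold l2; rw [map_smul, norm_smul]

lemma l2_sum_le {ι : Type*} (s : Finset ι) (F : ι → C(Ang, ℂ)) :
    l2 (∑ i ∈ s, F i) ≤ ∑ i ∈ s, l2 (F i) := by
  unfold l2; rw [map_sum]; exact norm_sum_le _ _

lemma integrable_of_continuous {f : Ang → ℝ} (hf : Continuous f) : Integrable f :=
  hf.integrable_of_hasCompactSupport (HasCompactSupport.of_compactSpace f)

lemma l2_sq (F : C(Ang, ℂ)) : l2 F ^ 2 = ∫ x, ‖F x‖ ^ 2 := by
  have h := ContinuousMap.inner_toLp (𝕜 := ℂ) (volume : Measure Ang) F F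
  rw [inner_self_eq_norm_sq_to_K] at h
  have h2 : ∀ x, F x * conj (F x) = ((‖F x‖ ^ 2 : ℝ) : ℂ) := by
    intro x; rw [Complex.mul_conj, Complex.normSq_eq_norm_sq]
  simp_rw [h2] at h
  rw [integral_complex_ofReal] at h
  unfold l2
  exact Complex.ofReal_injective ((Complex.ofReal_pow _ _).trans h)

lemma l2_twist (R : ℝ) (θ : Ang) (b : ℂ) (F : C(Ang, ℂ)) : l2 (twist R θ b F) = l2 F := by
  rw [← sq_eq_sq₀ (l2_nonneg _) (l2_nonneg _), l2_sq, l2_sq]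
  simp only [twist_apply, norm_mul, norm_phase, one_mul]
  exact integral_sub_right_eq_self (fun x => ‖F x‖ ^ 2) θ

lemma l2_le_of_norm_le {F : C(Ang, ℂ)} {M : ℝ} (h : ∀ x, ‖F x‖ ≤ M) :
    l2 F ≤ Real.sqrt (2 * Real.pi) * M := by
  have hM : 0 ≤ M := (norm_nonneg _).trans (h 0)
  rw [← abs_of_nonneg (l2_nonneg F), ← Real.sqrt_sq hM, ← Real.sqrt_mul Real.two_pi_pos.le]
  refine Real.abs_le_sqrt ?_
  rw [l2_sq]
  calc ∫ x, ‖F x‖ ^ 2 ≤ ∫ x : Ang, M ^ 2 := by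
        refine integral_mono (integrable_of_continuous (by fun_prop))
          (integrable_const _) fun x => ?_
        exact pow_le_pow_left₀ (norm_nonneg _) (h x) 2
    _ = 2 * Real.pi * M ^ 2 := by
        simp [Measure.real, AddCircle.measure_univ, Real.pi_pos.le]

/-- Cauchy–Schwarz against the constant 1 on a circle of mass 2π, from the nonnegativity of ∫ (2π‖F‖
- A)², where A is the L¹ norm. -/
lemma integral_norm_le_l2 (F : C(Ang, ℂ)) : ∫ x, ‖F x‖ ≤ Real.sqrt (2 * Real.pi) * l2 F := by
  have hnn : 0 ≤ ∫ x, ‖F x‖ := integral_nonneg fun x => norm_nonneg _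
  set A := ∫ x, ‖F x‖ with hA
  have h1 : 0 ≤ ∫ x, (2 * Real.pi * ‖F x‖ - A) ^ 2 := integral_nonneg fun x => sq_nonneg _
  have h2 : ∫ x, (2 * Real.pi * ‖F x‖ - A) ^ 2
      = (2 * Real.pi) ^ 2 * l2 F ^ 2 - 4 * Real.pi * A * A + 2 * Real.pi * A ^ 2 := by
    have : ∀ x, (2 * Real.pi * ‖F x‖ - A) ^ 2
      = (2 * Real.pi) ^ 2 * ‖F x‖ ^ 2 - 4 * Real.pi * A * ‖F x‖ + A ^ 2 := fun x => by ring
    simp_rw [this]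
    rw [integral_add, integral_sub, integral_const_mul, integral_const_mul, ← l2_sq, ← hA]
    · simp [Measure.real, AddCircle.measure_univ, Real.pi_pos.le]
    all_goals exact integrable_of_continuous (by fun_prop)
  rw [← abs_of_nonneg hnn, ← Real.sqrt_sq (l2_nonneg F), ← Real.sqrt_mul Real.two_pi_pos.le]
  refine Real.abs_le_sqrt ?_
  have hp := Real.pi_pos
  rw [h2] at h1
  have : 0 ≤ (2 * Real.pi) * (2 * Real.pi * l2 F ^ 2 - A ^ 2) := by linarith
  nlinarith [nonneg_of_mul_nonneg_right this Real.two_pi_pos]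

/-! ### The transfer operator -/

section Walk

variable {ι : Type*} [Fintype ι]

/-- The averaging operator of a random walk with weights `p`, rotation angles `θ` and translation
parts `b`, on the circle of radius `R`. -/
noncomputable def avgOp (p : ι → ℝ) (θ : ι → Ang) (b : ι → ℂ) (R : ℝ) :
    C(Ang, ℂ) →ₗ[ℂ] C(Ang, ℂ) :=
  ∑ i, (p i : ℂ) • twist R (θ i) (b i)

variable {p : ι → ℝ} {θ : ι → Ang} {b : ι → ℂ}

lemma avgOp_eq (R : ℝ) (F : C(Ang, ℂ)) :
    avgOp p θ b R F = ∑ i, (p i : ℂ) • twist R (θ i) (b i) F := by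
  simp [avgOp]

lemma avgOp_apply (R : ℝ) (F : C(Ang, ℂ)) (x : Ang) :
    avgOp p θ b R F x = ∑ i, (p i : ℂ) * (phase (R * inner ℝ (b i) (unitAt x)) * F (x - θ i)) := by
  simp [avgOp_eq, twist_apply]

lemma l2_avgOp_le (hp : ∀ i, 0 ≤ p i) (hp1 : ∑ i, p i = 1) (R : ℝ) (F : C(Ang, ℂ)) :
    l2 (avgOp p θ b R F) ≤ l2 F := by
  rw [avgOp_eq]
  refine (l2_sum_le _ _).trans ?_
  simp only [l2_smul, l2_twist, ← Finset.sum_mul]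
  rw [show ∑ i, ‖(p i : ℂ)‖ = 1 by
    rw [← hp1]; exact Finset.sum_congr rfl fun i _ => by simp [abs_of_nonneg (hp i)], one_mul]

lemma l2_avgOp_pow_le (hp : ∀ i, 0 ≤ p i) (hp1 : ∑ i, p i = 1) (R : ℝ) (n : ℕ) (F : C(Ang, ℂ)) :
    l2 ((avgOp p θ b R ^ n) F) ≤ l2 F := by
  induction n with
  | zero => simp
  | succ n ih =>
    rw [pow_succ', Module.End.mul_apply]
    exact (l2_avgOp_le hp hp1 _ _).trans ih

/-- The variance identity E|z - z'|² = 2E|z|² - 2|Ez|² for independent copies z, z'. -/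
lemma sum_norm_sub_sq (hp1 : ∑ i, p i = 1) (z : ι → ℂ) :
    ∑ i, ∑ j, p i * p j * ‖z i - z j‖ ^ 2
      = 2 * ∑ i, p i * ‖z i‖ ^ 2 - 2 * ‖∑ i, (p i : ℂ) * z i‖ ^ 2 := by
  have h : ∀ i j, p i * p j * ‖z i - z j‖ ^ 2 = p i * ‖z i‖ ^ 2 * p j + p i * (p j * ‖z j‖ ^ 2)
      - 2 * (((p i : ℂ) * z i) * conj ((p j : ℂ) * z j)).re := by
    intro i j
    simp only [← Complex.normSq_eq_norm_sq, Complex.normSq_apply]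
    simp
    ring
  have h3 : ∑ i, ∑ j, 2 * (((p i : ℂ) * z i) * conj ((p j : ℂ) * z j)).re
      = 2 * ‖∑ i, (p i : ℂ) * z i‖ ^ 2 := by
    rw [← Complex.normSq_eq_norm_sq, ← Complex.ofReal_re (Complex.normSq _), ← Complex.mul_conj,
      map_sum, Finset.sum_mul_sum, Complex.re_sum, Finset.mul_sum]
    refine Finset.sum_congr rfl fun i _ => ?_
    rw [Complex.re_sum, Finset.mul_sum]
  simp_rw [h, Finset.sum_sub_distrib, h3, Finset.sum_add_distrib, ← Finset.mul_sum,
    ← Finset.sum_mul, hp1]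
  ring

/-- The variance identity integrated over the circle. Twists are isometries, so the norm lost in
averaging measures exactly how much the twists disagree on F. -/
lemma sum_l2_twist_sub_sq (hp1 : ∑ i, p i = 1) (R : ℝ) (F : C(Ang, ℂ)) :
    ∑ i, ∑ j, p i * p j * l2 (twist R (θ i) (b i) F - twist R (θ j) (b j) F) ^ 2
      = 2 * (l2 F ^ 2 - l2 (avgOp p θ b R F) ^ 2) := by
  have h := fun x => sum_norm_sub_sq hp1 fun i => twist R (θ i) (b i) F x
  have hc : ∀ i, Continuous fun x => twist R (θ i) (b i) F x := fun i => map_continuous _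
  have h2 : ∑ i, p i * l2 F ^ 2 = l2 F ^ 2 := by rw [← Finset.sum_mul, hp1, one_mul]
  have e1 : ∫ x, ∑ i, ∑ j, p i * p j * ‖twist R (θ i) (b i) F x - twist R (θ j) (b j) F x‖ ^ 2
      = ∑ i, ∑ j, p i * p j * l2 (twist R (θ i) (b i) F - twist R (θ j) (b j) F) ^ 2 := by
    rw [integral_finsetSum _ fun i _ => integrable_of_continuous (by fun_prop)]
    refine Finset.sum_congr rfl fun i _ => ?_
    rw [integral_finsetSum _ fun i _ => integrable_of_continuous (by fun_prop)]
    refine Finset.sum_congr rfl fun j _ => ?_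
    rw [integral_const_mul, l2_sq]
    rfl
  rw [← e1]
  simp_rw [h]
  rw [integral_sub (integrable_of_continuous (by fun_prop))
    (integrable_of_continuous (by fun_prop)), integral_const_mul, integral_const_mul,
    integral_finsetSum _ fun i _ => integrable_of_continuous (by fun_prop)]
  simp_rw [integral_const_mul, ← l2_sq, l2_twist, h2]
  rw [l2_sq (avgOp p θ b R F), mul_sub]
  simp [avgOp_eq]

end Walk

/-! ### Iterated differences of a rotating sequence modulo `2π` -/

lemma norm_phase_sub_one_sub_le (x y : ℝ) :
    ‖phase (x - y) - 1‖ ≤ ‖phase x - 1‖ + ‖phase y - 1‖ := by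
  have h : phase x - phase y = phase y * (phase (x - y) - 1) := by
    rw [mul_sub, ← phase_add, mul_one, add_sub_cancel]
  have h2 : ‖phase (x - y) - 1‖ = ‖phase x - phase y‖ := by rw [h, norm_mul, norm_phase, one_mul]
  rw [h2, ← sub_sub_sub_cancel_right _ _ (1 : ℂ)]
  exact norm_sub_le _ _

lemma norm_phase_sub_one (x : ℝ) : ‖phase x - 1‖ = 2 * |Real.sin (x / 2)| := by
  rw [phase, mul_comm, Complex.norm_exp_I_mul_ofReal_sub_one, norm_mul, Real.norm_eq_abs,
    Real.norm_eq_abs, abs_two]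

lemma two_div_pi_mul_abs_le_norm_phase_sub_one {x : ℝ} (hx : |x| ≤ Real.pi) :
    2 / Real.pi * |x| ≤ ‖phase x - 1‖ := by
  have h2 : |x / 2| = |x| / 2 := by rw [abs_div, abs_two]
  have h := Real.mul_abs_le_abs_sin (x := x / 2) (by rw [h2]; linarith)
  rw [norm_phase_sub_one]
  rw [h2] at h
  linarith

lemma norm_phase_sub_one_le (x : ℝ) : ‖phase x - 1‖ ≤ |x| := by
  rw [norm_phase_sub_one]
  have := Real.abs_sin_le_abs (x := x / 2)
  rw [abs_div, abs_two] at this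
  linarith

/-- Closeness to 2πℤ, measured by |e^{ix} - 1|, is subadditive and hence survives differencing. Each
difference costs a factor 4: 2 for squaring a sum of two terms, and 2 because both are bounded by
the same sum S. -/
lemma norm_phase_iterated_diff_sq_le (w z : ℂ) (k : ℕ) :
    ‖phase ((z * (w - 1) ^ k).re) - 1‖ ^ 2
      ≤ 4 ^ k * ∑ i ∈ Finset.range (k + 1), ‖phase ((z * w ^ i).re) - 1‖ ^ 2 := by
  induction k generalizing z with
  | zero => simp
  | succ k ih =>
    have h1 : (z * (w - 1) ^ (k + 1)).re = (z * w * (w - 1) ^ k).re - (z * (w - 1) ^ k).re := by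
      rw [← Complex.sub_re]; congr 1; ring
    have hA := ih (z * w)
    have hB := ih z
    set S := ∑ i ∈ Finset.range (k + 1 + 1), ‖phase ((z * w ^ i).re) - 1‖ ^ 2 with hS
    have hA' : ∑ i ∈ Finset.range (k + 1), ‖phase ((z * w * w ^ i).re) - 1‖ ^ 2 ≤ S := by
      rw [hS, Finset.sum_range_succ' _ (k + 1)]
      refine le_add_of_le_of_nonneg (le_of_eq ?_) (sq_nonneg _)
      exact Finset.sum_congr rfl fun i _ => by rw [pow_succ' w, mul_assoc]
    have hB' : ∑ i ∈ Finset.range (k + 1), ‖phase ((z * w ^ i).re) - 1‖ ^ 2 ≤ S := by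
      rw [hS, Finset.sum_range_succ _ (k + 1)]
      exact le_add_of_nonneg_right (sq_nonneg _)
    have h4 : (0 : ℝ) ≤ 4 ^ k := by positivity
    have hA2 := hA.trans (mul_le_mul_of_nonneg_left hA' h4)
    have hB2 := hB.trans (mul_le_mul_of_nonneg_left hB' h4)
    have h2 := norm_phase_sub_one_sub_le (z * w * (w - 1) ^ k).re (z * (w - 1) ^ k).re
    rw [h1, pow_succ (4 : ℝ)]
    have h3 := pow_le_pow_left₀ (norm_nonneg _) h2 2
    nlinarith [sq_nonneg (‖phase (z * w * (w - 1) ^ k).re - 1‖ - ‖phase (z * (w - 1) ^ k).re - 1‖)]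

/-- Since Re(zw) = Re z Re w - Im z Im w, the two real parts determine Im z up to the factor Im w.
-/
lemma im_sq_mul_norm_sq_le (w z : ℂ) (hw : ‖w‖ = 1) :
    w.im ^ 2 * ‖z‖ ^ 2 ≤ 3 * (z.re ^ 2 + (z * w).re ^ 2) := by
  have h1 : w.re ^ 2 + w.im ^ 2 = 1 := by
    have := Complex.normSq_eq_norm_sq w
    rw [hw, Complex.normSq_apply] at this
    linarith
  rw [← Complex.normSq_eq_norm_sq, Complex.normSq_apply, Complex.mul_re]
  nlinarith [sq_nonneg (z.re * w.re + (z.re * w.re - z.im * w.im)), sq_nonneg (z.re * w.im),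
    sq_nonneg (z.re * w.re - z.im * w.im), mul_nonneg (sq_nonneg z.re) (sq_nonneg w.re)]

/-- After k differences with step q the vector z becomes z(w^q - 1)^k, of modulus at most π, where
|e^{ix} - 1| is comparable to |x|. Doing this for z and for zw, whence the exponents iq and iq + 1,
controls the whole vector and not only its real part. -/
lemma rotating_sequence_lower_bound {w : ℂ} (hw : ‖w‖ = 1) (z : ℂ) (k q : ℕ)
    (hz : ‖z‖ * ‖w ^ q - 1‖ ^ k ≤ Real.pi) :
    w.im ^ 2 * (‖z‖ * ‖w ^ q - 1‖ ^ k) ^ 2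
      ≤ 3 * (Real.pi ^ 2 / 4) * 4 ^ k * ∑ i ∈ Finset.range (k + 1),
        (‖phase ((z * w ^ (i * q)).re) - 1‖ ^ 2 + ‖phase ((z * w ^ (i * q + 1)).re) - 1‖ ^ 2) := by
  set y : ℂ := z * (w ^ q - 1) ^ k with hy
  have hny : ‖y‖ = ‖z‖ * ‖w ^ q - 1‖ ^ k := by rw [hy, norm_mul, norm_pow]
  have hlow : ∀ y' : ℂ, ‖y'‖ ≤ Real.pi →
      y'.re ^ 2 ≤ Real.pi ^ 2 / 4 * ‖phase y'.re - 1‖ ^ 2 := by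
    intro y' hy'
    have h := two_div_pi_mul_abs_le_norm_phase_sub_one ((Complex.abs_re_le_norm y').trans hy')
    have h2 := pow_le_pow_left₀ (by positivity) h 2
    rw [mul_pow, sq_abs, div_pow] at h2
    have hp := Real.pi_pos
    have h3 : Real.pi ^ 2 / 4 * (2 ^ 2 / Real.pi ^ 2 * y'.re ^ 2) = y'.re ^ 2 := by
      field_simp; norm_num
    rw [← h3]
    exact mul_le_mul_of_nonneg_left h2 (by positivity)
  have h1 := hlow y (hny.trans_le hz)
  have h2 := hlow (y * w) (by rw [norm_mul, hw, mul_one]; exact hny.trans_le hz)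
  have h3 := im_sq_mul_norm_sq_le w y hw
  have d1 := norm_phase_iterated_diff_sq_le (w ^ q) z k
  have d2 := norm_phase_iterated_diff_sq_le (w ^ q) (z * w) k
  have e2 : z * w * (w ^ q - 1) ^ k = y * w := by rw [hy]; ring
  rw [e2] at d2
  have e3 : ∀ i, z * w * (w ^ q) ^ i = z * w ^ (i * q + 1) := fun i => by
    rw [← pow_mul, mul_comm q i]; ring
  have e4 : ∀ i, z * (w ^ q) ^ i = z * w ^ (i * q) := fun i => by rw [← pow_mul, mul_comm q i]
  simp_rw [e3] at d2
  simp_rw [e4, ← hy] at d1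
  rw [← hny, Finset.sum_add_distrib]
  have hp : 0 < Real.pi ^ 2 / 4 := by have := Real.pi_pos; positivity
  have d1' := mul_le_mul_of_nonneg_left d1 hp.le
  have d2' := mul_le_mul_of_nonneg_left d2 hp.le
  linarith

/-! ### The spectral gap -/

section Walk

variable {ι : Type*} [Fintype ι] {p : ι → ℝ} {θ : ι → Ang} {b : ι → ℂ}

/-- `Reach θ b n x t` says that the isometry with rotation angle `x` and translation part `t` is a
product of `n` of the isometries `(θ i, b i)`. -/
inductive Reach {ι : Type*} (θ : ι → Ang) (b : ι → ℂ) : ℕ → Ang → ℂ → Prop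
  | zero : Reach θ b 0 0 0
  | step (i : ι) {n : ℕ} {x : Ang} {t : ℂ} :
      Reach θ b n x t → Reach θ b (n + 1) (θ i + x) (b i + unitAt (θ i) * t)

/-- The difference is an average of pairwise differences of twists; each pair has weight at least c²
in the variance identity, so each is controlled by the norm loss. -/
lemma l2_twist_sub_avgOp_le (hp : ∀ i, 0 < p i) (hp1 : ∑ i, p i = 1) {c : ℝ} (hc : 0 < c)
    (hcp : ∀ i, c ≤ p i) (R : ℝ) (F : C(Ang, ℂ)) (i : ι) :
    l2 (twist R (θ i) (b i) F - avgOp p θ b R F)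
      ≤ Real.sqrt (2 * (l2 F ^ 2 - l2 (avgOp p θ b R F) ^ 2)) / c := by
  set D := 2 * (l2 F ^ 2 - l2 (avgOp p θ b R F) ^ 2) with hD
  have hij : ∀ j, l2 (twist R (θ i) (b i) F - twist R (θ j) (b j) F) ≤ Real.sqrt D / c := by
    intro j
    rw [le_div_iff₀ hc]
    refine Real.le_sqrt_of_sq_le ?_
    rw [hD, ← sum_l2_twist_sub_sq hp1]
    have hnn : ∀ i j, 0 ≤ p i * p j * l2 (twist R (θ i) (b i) F - twist R (θ j) (b j) F) ^ 2 :=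
      fun i j => mul_nonneg (mul_pos (hp i) (hp j)).le (sq_nonneg _)
    refine le_trans ?_ (Finset.single_le_sum (fun i _ => Finset.sum_nonneg fun j _ => hnn i j)
      (Finset.mem_univ i))
    refine le_trans ?_ (Finset.single_le_sum (fun j _ => hnn i j) (Finset.mem_univ j))
    rw [mul_pow, mul_comm, sq c]
    exact mul_le_mul_of_nonneg_right (mul_le_mul (hcp i) (hcp j) hc.le (hp i).le) (sq_nonneg _)
  have h1 : twist R (θ i) (b i) F - avgOp p θ b R F
      = ∑ j, (p j : ℂ) • (twist R (θ i) (b i) F - twist R (θ j) (b j) F) := by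
    simp_rw [smul_sub, Finset.sum_sub_distrib, ← Finset.sum_smul, ← avgOp_eq]
    rw [← Complex.ofReal_sum, hp1, Complex.ofReal_one, one_smul]
  rw [h1]
  refine (l2_sum_le _ _).trans ?_
  calc ∑ j, l2 ((p j : ℂ) • (twist R (θ i) (b i) F - twist R (θ j) (b j) F))
      ≤ ∑ j, p j * (Real.sqrt D / c) := by
        refine Finset.sum_le_sum fun j _ => ?_
        rw [l2_smul, Complex.norm_real, Real.norm_eq_abs, abs_of_pos (hp j)]
        exact mul_le_mul_of_nonneg_left (hij j) (hp j).le
    _ = Real.sqrt D / c := by rw [← Finset.sum_mul, hp1, one_mul]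

/-- The letters of a word are replaced one by one by the averaging operator, innermost first; each
replacement costs ε since the outer twists are isometries. -/
lemma Reach.l2_twist_sub_le {R ε : ℝ} {F : C(Ang, ℂ)} {n : ℕ} {x : Ang} {t : ℂ}
    (h : Reach θ b n x t)
    (hε : ∀ j < n, ∀ i, l2 (twist R (θ i) (b i) ((avgOp p θ b R ^ j) F)
      - avgOp p θ b R ((avgOp p θ b R ^ j) F)) ≤ ε) :
    l2 (twist R x t F - (avgOp p θ b R ^ n) F) ≤ n * ε := by
  induction h with
  | zero => simp [twist_zero, l2]
  | @step i n x t h ih =>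
    have ih' := ih fun j hj => hε j (hj.trans n.lt_succ_self)
    have h2 := hε n n.lt_succ_self i
    rw [← twist_twist, pow_succ', Module.End.mul_apply]
    refine (l2_sub_le_sub_add_sub _ (twist R (θ i) (b i) ((avgOp p θ b R ^ n) F)) _).trans ?_
    rw [← map_sub, l2_twist]
    push_cast
    linarith

lemma l2_twist_sub_twist_sq (R : ℝ) (x : Ang) (t t' : ℂ) (F : C(Ang, ℂ)) :
    l2 (twist R x t F - twist R x t' F) ^ 2
      = ∫ v, ‖phase (R * inner ℝ (t - t') (unitAt (v + x))) - 1‖ ^ 2 * ‖F v‖ ^ 2 := by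
  rw [l2_sq, ← integral_add_right_eq_self _ x]
  refine integral_congr_ae (.of_forall fun v => ?_)
  simp only [ContinuousMap.sub_apply, twist_apply, add_sub_cancel_right]
  have h : phase (R * inner ℝ t (unitAt (v + x))) = phase (R * inner ℝ t' (unitAt (v + x)))
      * phase (R * inner ℝ (t - t') (unitAt (v + x))) := by
    rw [← phase_add, ← mul_add, ← inner_add_left, add_sub_cancel]
  rw [h, ← mul_pow, mul_assoc, ← mul_sub, norm_mul, norm_phase, one_mul, ← sub_one_mul, norm_mul]

/-- Both words send F close to the same n-th iterate, hence close to each other; having the same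
rotation, they differ only by a phase factor. -/
lemma Reach.integral_le (hp : ∀ i, 0 < p i) (hp1 : ∑ i, p i = 1) {c : ℝ} (hc : 0 < c)
    (hcp : ∀ i, c ≤ p i) (R : ℝ) (F : C(Ang, ℂ)) {n ℓ : ℕ} (hn : n ≤ ℓ) {x : Ang} {t t' : ℂ}
    (h : Reach θ b n x t) (h' : Reach θ b n x t') :
    ∫ v, ‖phase (R * inner ℝ (t - t') (unitAt (v + x))) - 1‖ ^ 2 * ‖F v‖ ^ 2
      ≤ 8 * ℓ ^ 2 * (l2 F ^ 2 - l2 ((avgOp p θ b R ^ ℓ) F) ^ 2) / c ^ 2 := by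
  set E := l2 F ^ 2 - l2 ((avgOp p θ b R ^ ℓ) F) ^ 2 with hE
  have hp0 : ∀ i, 0 ≤ p i := fun i => (hp i).le
  have hE0 : 0 ≤ E := by
    rw [hE, sub_nonneg]
    exact pow_le_pow_left₀ (l2_nonneg _) (l2_avgOp_pow_le hp0 hp1 _ _ _) 2
  have key : ∀ j < n, ∀ i, l2 (twist R (θ i) (b i) ((avgOp p θ b R ^ j) F)
      - avgOp p θ b R ((avgOp p θ b R ^ j) F)) ≤ Real.sqrt (2 * E) / c := by
    intro j hj i
    refine (l2_twist_sub_avgOp_le hp hp1 hc hcp R _ i).trans ?_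
    refine div_le_div_of_nonneg_right (Real.sqrt_le_sqrt ?_) hc.le
    -- Norms decrease along the iteration, so the loss in any single step is at most the total loss
    -- E.
    have h1 := l2_avgOp_pow_le (p := p) (θ := θ) (b := b) hp0 hp1 R j F
    have h2 := l2_avgOp_pow_le (p := p) (θ := θ) (b := b) hp0 hp1 R (ℓ - (j + 1))
      ((avgOp p θ b R ^ (j + 1)) F)
    rw [← Module.End.mul_apply, ← pow_add, Nat.sub_add_cancel (by omega)] at h2
    rw [← Module.End.mul_apply, ← pow_succ']
    have h1' := pow_le_pow_left₀ (l2_nonneg _) h1 2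
    have h2' := pow_le_pow_left₀ (l2_nonneg _) h2 2
    linarith
  have a1 := h.l2_twist_sub_le key
  have a2 := h'.l2_twist_sub_le key
  have a3 := l2_sub_le_sub_add_sub (twist R x t F) ((avgOp p θ b R ^ n) F) (twist R x t' F)
  rw [l2_sub_comm ((avgOp p θ b R ^ n) F)] at a3
  have hnl : (n : ℝ) ≤ ℓ := by exact_mod_cast hn
  have hs : 0 ≤ Real.sqrt (2 * E) / c := by positivity
  have a4 : l2 (twist R x t F - twist R x t' F) ≤ 2 * (ℓ * (Real.sqrt (2 * E) / c)) := by
    have := mul_le_mul_of_nonneg_right hnl hs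
    linarith
  rw [← l2_twist_sub_twist_sq]
  refine (pow_le_pow_left₀ (l2_nonneg _) a4 2).trans (le_of_eq ?_)
  rw [mul_pow, mul_pow, div_pow, Real.sq_sqrt (by positivity)]
  ring

/-- The spectral gap of the averaging operator on the circle of radius `R`. -/
theorem spectral_gap (hp : ∀ i, 0 < p i) (hp1 : ∑ i, p i = 1) {c : ℝ} (hc : 0 < c)
    (hcp : ∀ i, c ≤ p i) {α : Ang}
    (hreach : ∀ K : ℕ, ∃ γ : Ang, ∀ k ≤ K, ∃ n ≤ K, ∃ s, Reach θ b n (γ + k • α) s)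
    (i₁ i₂ : ι) {τ : ℂ}
    (hτ : τ = (b i₁ + unitAt (θ i₁) * b i₂) - (b i₂ + unitAt (θ i₂) * b i₁))
    {R : ℝ} (hR : 0 ≤ R) (k q : ℕ)
    (hRk : R * ‖τ‖ * ‖unitAt α ^ q - 1‖ ^ k ≤ Real.pi) (F : C(Ang, ℂ)) :
    c ^ 2 * (unitAt α).im ^ 2 * ‖τ‖ ^ 2 * (R * ‖unitAt α ^ q - 1‖ ^ k) ^ 2 * l2 F ^ 2
      ≤ 12 * Real.pi ^ 2 * (4 ^ k * (k + 1) * (k * q + 3) ^ 2)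
        * (l2 F ^ 2 - l2 ((avgOp p θ b R ^ (k * q + 3)) F) ^ 2) := by
  set ω := unitAt α with hω
  set η := ‖ω ^ q - 1‖ with hη
  set E := l2 F ^ 2 - l2 ((avgOp p θ b R ^ (k * q + 3)) F) ^ 2 with hE
  -- The exponents iq and iq + 1 with i ≤ k reach up to kq + 1; the two letters put in front of the
  -- tail make the length at most kq + 3.
  obtain ⟨γ, hγ⟩ := hreach (k * q + 1)
  set x₀ := θ i₁ + θ i₂ + γ with hx₀
  have hInt : ∀ m ≤ k * q + 1, ∫ v, ‖phase ((R * conj τ * unitAt (v + x₀) * ω ^ m).re) - 1‖ ^ 2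
      * ‖F v‖ ^ 2 ≤ 8 * (k * q + 3) ^ 2 * E / c ^ 2 := by
    intro m hm
    obtain ⟨n, hn, s, hs⟩ := hγ m hm
    -- The same tail preceded by the two letters in either order: the tail's translation s cancels
    -- in the difference, leaving τ.
    have r1 := (hs.step i₂).step i₁
    have r2 := (hs.step i₁).step i₂
    rw [← add_assoc] at r1 r2
    rw [add_comm (θ i₂)] at r2
    have h := Reach.integral_le hp hp1 hc hcp R F (ℓ := k * q + 3) (by omega) r1 r2
    push_cast at h
    refine le_trans (le_of_eq ?_) h
    refine integral_congr_ae (.of_forall fun v => ?_)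
    simp only
    congr 4
    have e1 : b i₁ + unitAt (θ i₁) * (b i₂ + unitAt (θ i₂) * s)
        - (b i₂ + unitAt (θ i₂) * (b i₁ + unitAt (θ i₁) * s)) = τ := by rw [hτ]; ring
    rw [e1, Complex.inner, ← Complex.re_ofReal_mul]
    have e2 : v + (θ i₁ + θ i₂ + (γ + m • α)) = v + x₀ + m • α := by rw [hx₀]; abel
    rw [e2, unitAt_add _ (m • α), unitAt_nsmul, ← hω, mul_assoc (R * conj τ), mul_assoc (R : ℂ),
      mul_comm (conj τ)]
  have hpt : ∀ v, ω.im ^ 2 * (R * ‖τ‖ * η ^ k) ^ 2 * ‖F v‖ ^ 2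
      ≤ 3 * (Real.pi ^ 2 / 4) * 4 ^ k * ∑ i ∈ Finset.range (k + 1),
        (‖phase ((R * conj τ * unitAt (v + x₀) * ω ^ (i * q)).re) - 1‖ ^ 2 * ‖F v‖ ^ 2
        + ‖phase ((R * conj τ * unitAt (v + x₀) * ω ^ (i * q + 1)).re) - 1‖ ^ 2 * ‖F v‖ ^ 2) := by
    intro v
    have hz : ‖(R : ℂ) * conj τ * unitAt (v + x₀)‖ = R * ‖τ‖ := by
      rw [norm_mul, norm_mul, norm_unitAt, mul_one, RCLike.norm_conj, Complex.norm_real,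
        Real.norm_eq_abs, abs_of_nonneg hR]
    have h := rotating_sequence_lower_bound (w := ω) (norm_unitAt α)
      ((R : ℂ) * conj τ * unitAt (v + x₀)) k q (by rw [hz]; exact hRk)
    rw [hz] at h
    simp_rw [← add_mul, ← Finset.sum_mul, ← mul_assoc]
    exact mul_le_mul_of_nonneg_right h (sq_nonneg _)
  have hcont : ∀ m : ℕ, Continuous fun v : Ang =>
      ‖phase ((R * conj τ * unitAt (v + x₀) * ω ^ m).re) - 1‖ ^ 2 * ‖F v‖ ^ 2 := by
    intro m
    have h1 := continuous_unitAt
    have h2 := continuous_phase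
    have h3 : Continuous fun v : Ang => (R * conj τ * unitAt (v + x₀) * ω ^ m).re :=
      Complex.continuous_re.comp (by fun_prop)
    fun_prop
  have hI := integral_mono (integrable_of_continuous (by fun_prop))
    (integrable_of_continuous (by fun_prop)) hpt
  rw [integral_const_mul, integral_const_mul, ← l2_sq,
    integral_finsetSum _ fun i _ => integrable_of_continuous (by fun_prop)] at hI
  have hsum : ∑ i ∈ Finset.range (k + 1), ∫ v,
        (‖phase ((R * conj τ * unitAt (v + x₀) * ω ^ (i * q)).re) - 1‖ ^ 2 * ‖F v‖ ^ 2
        + ‖phase ((R * conj τ * unitAt (v + x₀) * ω ^ (i * q + 1)).re) - 1‖ ^ 2 * ‖F v‖ ^ 2)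
      ≤ (k + 1) * (16 * (k * q + 3) ^ 2 * E / c ^ 2) := by
    have h1 : ∀ i ∈ Finset.range (k + 1), ∫ v,
        (‖phase ((R * conj τ * unitAt (v + x₀) * ω ^ (i * q)).re) - 1‖ ^ 2 * ‖F v‖ ^ 2
        + ‖phase ((R * conj τ * unitAt (v + x₀) * ω ^ (i * q + 1)).re) - 1‖ ^ 2 * ‖F v‖ ^ 2)
        ≤ 16 * (k * q + 3) ^ 2 * E / c ^ 2 := by
      intro i hi
      rw [integral_add (integrable_of_continuous (hcont _)) (integrable_of_continuous (hcont _))]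
      have hik : i * q ≤ k * q := Nat.mul_le_mul_right _ (by simpa [Nat.lt_succ_iff] using hi)
      have h1 := hInt (i * q) (by omega)
      have h2 := hInt (i * q + 1) (by omega)
      refine (add_le_add h1 h2).trans (le_of_eq ?_)
      ring
    refine (Finset.sum_le_sum h1).trans (le_of_eq ?_)
    rw [Finset.sum_const, Finset.card_range, nsmul_eq_mul]
    push_cast
    ring
  have hfin := hI.trans (mul_le_mul_of_nonneg_left hsum (by positivity))
  have := mul_le_mul_of_nonneg_left hfin (sq_nonneg c)
  refine le_trans (le_of_eq ?_) (this.trans (le_of_eq ?_))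
  · ring
  · field_simp
    ring

end Walk

/-! ### Diophantine angles -/

lemma phase_sub_nearest_multiple (α : ℝ) (q : ℕ) :
    |q * α - 2 * Real.pi * round (q * (α / (2 * Real.pi)))|
        = 2 * Real.pi * |q * (α / (2 * Real.pi)) - round (q * (α / (2 * Real.pi)))| ∧
      phase (q * α - 2 * Real.pi * round (q * (α / (2 * Real.pi)))) = unitAt (α : Ang) ^ q := by
  have hp := Real.two_pi_pos
  constructor
  · rw [← abs_of_pos hp, ← abs_mul, abs_of_pos hp]
    congr 1
    field_simp
  · rw [unitAt_coe, ← Complex.exp_nat_mul, phase]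
    rw [Complex.exp_eq_exp_iff_exists_int]
    refine ⟨-round (q * (α / (2 * Real.pi))), ?_⟩
    push_cast
    ring

/-- Dirichlet's approximation theorem for α/2π. -/
lemma exists_norm_unitAt_pow_sub_one_le (α : ℝ) {Q : ℕ} (hQ : 0 < Q) :
    ∃ q : ℕ, 0 < q ∧ q ≤ Q ∧ ‖unitAt (α : Ang) ^ q - 1‖ ≤ 2 * Real.pi / Q := by
  obtain ⟨q, hq0, hqQ, hq⟩ := Real.exists_nat_abs_mul_sub_round_le (α / (2 * Real.pi)) hQ
  refine ⟨q, hq0, hqQ, ?_⟩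
  obtain ⟨h1, h2⟩ := phase_sub_nearest_multiple α q
  rw [← h2]
  refine (norm_phase_sub_one_le _).trans ?_
  rw [h1, div_eq_mul_one_div (2 * Real.pi) (Q : ℝ)]
  refine mul_le_mul_of_nonneg_left (hq.trans ?_) Real.two_pi_pos.le
  have : (0 : ℝ) < Q := by exact_mod_cast hQ
  exact one_div_le_one_div_of_le this (by linarith)

lemma norm_pow_sub_one_le {w : ℂ} (hw : ‖w‖ = 1) (n : ℕ) : ‖w ^ n - 1‖ ≤ n * ‖w - 1‖ := by
  induction n with
  | zero => simp
  | succ n ih =>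
    have : w ^ (n + 1) - 1 = w * (w ^ n - 1) + (w - 1) := by ring
    rw [this]
    refine (norm_add_le _ _).trans ?_
    rw [norm_mul, hw]
    push_cast
    linarith

/-- For q ≥ q₀ the chord is comparable to the distance from qα to 2πℤ, which the Diophantine
condition bounds below. For every other q > 0 one passes to the multiple q(q₀ + 1), as ‖w^n - 1‖
grows at most linearly in n. In particular no positive power of the rotation is trivial. -/
lemma DiophantineAngle.exists_lower_bound {m α : ℝ} (h : DiophantineAngle m α) :
    ∃ c : ℝ, 0 < c ∧ ∃ M : ℕ, ∀ q : ℕ, 0 < q → c ≤ ‖unitAt (α : Ang) ^ q - 1‖ * q ^ M := by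
  obtain ⟨q₀, hq₀⟩ := h
  set M := ⌈m⌉₊
  have hp := Real.pi_pos
  have large : ∀ q : ℕ, 0 < q → q₀ ≤ q →
      2 / Real.pi ≤ ‖unitAt (α : Ang) ^ q - 1‖ * (q : ℝ) ^ M := by
    intro q hq hqq
    obtain ⟨h1, h2⟩ := phase_sub_nearest_multiple α q
    set P := round (q * (α / (2 * Real.pi)))
    have hle : |q * α - 2 * Real.pi * P| ≤ Real.pi := by
      have := abs_sub_round (q * (α / (2 * Real.pi)))
      rw [h1]
      nlinarith
    have h3 := two_div_pi_mul_abs_le_norm_phase_sub_one hle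
    rw [h2] at h3
    have hq' : (1 : ℝ) ≤ q := by exact_mod_cast hq
    have hq0 : (0 : ℝ) < q := by linarith
    have h4 := hq₀ q hqq P
    have h5 : |q * α - 2 * Real.pi * P| = q * |α - 2 * Real.pi * P / q| := by
      rw [← abs_of_pos hq0, ← abs_mul, abs_of_pos hq0]
      congr 1
      field_simp
    have h6 : (q : ℝ) ^ (-m) * (q : ℝ) ^ M ≥ 1 := by
      rw [← Real.rpow_natCast, ← Real.rpow_add hq0]
      exact Real.one_le_rpow hq' (by linarith [Nat.le_ceil m])
    have h7 : 1 ≤ |q * α - 2 * Real.pi * P| * (q : ℝ) ^ M := by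
      rw [h5]
      calc (1 : ℝ) ≤ (q : ℝ) ^ (-m) * (q : ℝ) ^ M := h6
        _ ≤ |α - 2 * Real.pi * P / q| * (q : ℝ) ^ M := by gcongr
        _ ≤ q * |α - 2 * Real.pi * P / q| * (q : ℝ) ^ M := by
          gcongr
          exact le_mul_of_one_le_left (abs_nonneg _) hq'
    calc 2 / Real.pi ≤ 2 / Real.pi * (|q * α - 2 * Real.pi * P| * (q : ℝ) ^ M) :=
          le_mul_of_one_le_right (by positivity) h7
      _ = 2 / Real.pi * |q * α - 2 * Real.pi * P| * (q : ℝ) ^ M := by ring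
      _ ≤ _ := by gcongr
  set k := q₀ + 1
  have hk : (0 : ℝ) < k := by positivity
  refine ⟨2 / Real.pi / (k * k ^ M), by positivity, M, fun q hq => ?_⟩
  have h1 := large (q * k) (by positivity)
    ((Nat.le_succ q₀).trans (Nat.le_mul_of_pos_left k hq))
  have h2 := norm_pow_sub_one_le (w := unitAt (α : Ang) ^ q) (by simp [norm_unitAt]) k
  rw [← pow_mul] at h2
  rw [div_le_iff₀ (by positivity)]
  push_cast [mul_pow] at h1
  calc 2 / Real.pi ≤ _ := h1
    _ ≤ (k * ‖unitAt (α : Ang) ^ q - 1‖) * (q ^ M * k ^ M) := by gcongr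
    _ = _ := by ring

lemma norm_pow_sub_one_pos_of_lower_bound {w : ℂ} {c : ℝ} (hc : 0 < c) {M : ℕ}
    (hD : ∀ q : ℕ, 0 < q → c ≤ ‖w ^ q - 1‖ * q ^ M) {q : ℕ} (hq : 0 < q) : 0 < ‖w ^ q - 1‖ :=
  pos_of_mul_pos_left (hc.trans_le (hD q hq)) (by positivity)

lemma im_ne_zero_of_sq_ne_one {w : ℂ} (hw : ‖w‖ = 1) (h : w ^ 2 ≠ 1) : w.im ≠ 0 := by
  intro h0
  have h1 : w = (w.re : ℂ) := Complex.ext rfl (by simp [h0])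
  rw [h1, Complex.norm_real, Real.norm_eq_abs] at hw
  apply h
  rw [h1]
  have : w.re ^ 2 = 1 := by rw [← sq_abs, hw, one_pow]
  exact_mod_cast this

/-! ### Decay of the iterates -/

section Walk

variable {ι : Type*} [Fintype ι] {p : ι → ℝ} {θ : ι → Ang} {b : ι → ℂ}

/-- Each block of ℓ steps multiplies the squared norm by at most 1 - δ ≤ e^{-δ}, and N steps contain
N / ℓ full blocks. -/
lemma l2_avgOp_pow_sq_le_exp (hp : ∀ i, 0 ≤ p i) (hp1 : ∑ i, p i = 1) {R δ : ℝ} {ℓ : ℕ}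
    (h : ∀ F, δ * l2 F ^ 2 ≤ l2 F ^ 2 - l2 ((avgOp p θ b R ^ ℓ) F) ^ 2) (N : ℕ) (F : C(Ang, ℂ)) :
    l2 ((avgOp p θ b R ^ N) F) ^ 2 ≤ Real.exp (-δ * (N / ℓ : ℕ)) * l2 F ^ 2 := by
  have main : ∀ j : ℕ, l2 ((avgOp p θ b R ^ (ℓ * j)) F) ^ 2 ≤ Real.exp (-δ * j) * l2 F ^ 2 := by
    intro j
    induction j with
    | zero => simp
    | succ j ih =>
      have h1 := h ((avgOp p θ b R ^ (ℓ * j)) F)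
      rw [← Module.End.mul_apply, ← pow_add, add_comm ℓ, ← Nat.mul_succ] at h1
      have h2 : 1 - δ ≤ Real.exp (-δ) := by linarith [Real.add_one_le_exp (-δ)]
      have h3 := mul_le_mul_of_nonneg_right h2 (sq_nonneg (l2 ((avgOp p θ b R ^ (ℓ * j)) F)))
      have h4 := mul_le_mul_of_nonneg_left ih (Real.exp_pos (-δ)).le
      rw [← mul_assoc, ← Real.exp_add] at h4
      push_cast
      rw [show -δ * ((j : ℝ) + 1) = -δ + -δ * j by ring]
      linarith
  have h1 := main (N / ℓ)
  have h2 := l2_avgOp_pow_le (θ := θ) (b := b) hp hp1 R (N - ℓ * (N / ℓ))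
    ((avgOp p θ b R ^ (ℓ * (N / ℓ))) F)
  rw [← Module.End.mul_apply, ← pow_add, Nat.sub_add_cancel (Nat.mul_div_le N ℓ)] at h2
  exact (pow_le_pow_left₀ (l2_nonneg _) h2 2).trans h1

/-- The hypotheses on a walk, in terms of the weights, rotation angles and translation parts of its
steps, under which the averaging operator has a spectral gap. -/
structure GapData (p : ι → ℝ) (θ : ι → Ang) (b : ι → ℂ) (α : ℝ) (i₁ i₂ : ι) (M : ℕ) : Prop where
  pos : ∀ i, 0 < p i
  sum_eq_one : ∑ i, p i = 1
  reach : ∀ K : ℕ, ∃ γ : Ang, ∀ k ≤ K, ∃ n ≤ K, ∃ s, Reach θ b n (γ + k • (α : Ang)) s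
  ne : (b i₁ + unitAt (θ i₁) * b i₂) - (b i₂ + unitAt (θ i₂) * b i₁) ≠ 0
  dioph : ∃ c : ℝ, 0 < c ∧ ∀ q : ℕ, 0 < q → c ≤ ‖unitAt (α : Ang) ^ q - 1‖ * q ^ M

lemma GapData.exists_gap {α : ℝ} {i₁ i₂ : ι} {M : ℕ} (h : GapData p θ b α i₁ i₂ M) :
    ∃ c > 0, ∃ ρ > 0, ∀ R : ℝ, 0 ≤ R → ∀ k q : ℕ,
      R * ‖unitAt (α : Ang) ^ q - 1‖ ^ k ≤ ρ → ∀ F,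
      c * (R * ‖unitAt (α : Ang) ^ q - 1‖ ^ k) ^ 2 / (4 ^ k * (k + 1) * (k * q + 3) ^ 2) * l2 F ^ 2
        ≤ l2 F ^ 2 - l2 ((avgOp p θ b R ^ (k * q + 3)) F) ^ 2 := by
  set τ := (b i₁ + unitAt (θ i₁) * b i₂) - (b i₂ + unitAt (θ i₂) * b i₁) with hτ
  have hτ0 : 0 < ‖τ‖ := norm_pos_iff.2 h.ne
  obtain ⟨cp, hcp0, hcp⟩ : ∃ c : ℝ, 0 < c ∧ ∀ i, c ≤ p i := by
    have : Nonempty ι := ⟨i₁⟩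
    obtain ⟨i, hi⟩ := Finite.exists_min p
    exact ⟨p i, h.pos i, hi⟩
  obtain ⟨cD, hcD, hD⟩ := h.dioph
  have him : (unitAt (α : Ang)).im ≠ 0 := by
    -- The lower bound at q = 2 excludes the rotations ±1.
    refine im_ne_zero_of_sq_ne_one (norm_unitAt _) ?_
    have := norm_pow_sub_one_pos_of_lower_bound hcD hD two_pos
    exact sub_ne_zero.1 (norm_pos_iff.1 this)
  have hpi := Real.pi_pos
  refine ⟨cp ^ 2 * (unitAt (α : Ang)).im ^ 2 * ‖τ‖ ^ 2 / (12 * Real.pi ^ 2), by positivity,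
    Real.pi / ‖τ‖, by positivity, fun R hR k q hk F => ?_⟩
  have := spectral_gap (b := b) h.pos h.sum_eq_one hcp0 hcp h.reach i₁ i₂ hτ hR k q
    (by rw [le_div_iff₀ hτ0] at hk; linarith) F
  rw [div_mul_eq_mul_div, div_mul_eq_mul_div, div_mul_eq_mul_div, div_div,
    div_le_iff₀ (by positivity)]
  linarith

lemma GapData.exists_low_decay {α : ℝ} {i₁ i₂ : ι} {M : ℕ} (h : GapData p θ b α i₁ i₂ M) {ρ : ℝ}
    (hgap : ∃ c > 0, ∀ R : ℝ, 0 ≤ R → R ≤ ρ → ∀ F,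
      c * R ^ 2 * l2 F ^ 2 ≤ l2 F ^ 2 - l2 ((avgOp p θ b R ^ 3) F) ^ 2) :
    ∃ C > 0, ∃ c > 0, ∀ R : ℝ, 0 ≤ R → R ≤ ρ → ∀ (N : ℕ) F,
      l2 ((avgOp p θ b R ^ N) F) ≤ C * Real.exp (-c * N * R ^ 2) * l2 F := by
  obtain ⟨c, hc, hgap⟩ := hgap
  -- Rounding down in N / 3 costs the constant factor; the rate c/3 for squared norms is halved for
  -- norms.
  refine ⟨Real.exp (c * ρ ^ 2), Real.exp_pos _, c / 6, by positivity, fun R hR hRρ N F => ?_⟩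
  have h1 := l2_avgOp_pow_sq_le_exp (fun i => (h.pos i).le) h.sum_eq_one (hgap R hR hRρ) N F
  have h2 : Real.exp (-(c * R ^ 2) * (N / 3 : ℕ))
      ≤ (Real.exp (c * ρ ^ 2) * Real.exp (-(c / 6) * N * R ^ 2)) ^ 2 := by
    rw [← Real.exp_add, ← Real.exp_nat_mul, Real.exp_le_exp]
    have h3 : (N : ℝ) / 3 - 1 ≤ (N / 3 : ℕ) := by
      have : N < 3 * (N / 3 + 1) := Nat.lt_mul_div_succ N (by norm_num)
      have : (N : ℝ) < 3 * ((N / 3 : ℕ) + 1) := by exact_mod_cast this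
      linarith
    have h4 := mul_le_mul_of_nonneg_left h3 (by positivity : 0 ≤ c * R ^ 2)
    have h5 : c * R ^ 2 ≤ c * ρ ^ 2 := by gcongr
    have h6 : 0 ≤ c * ρ ^ 2 := by positivity
    push_cast at *
    linarith
  refine le_of_sq_le_sq ?_ (mul_nonneg (by positivity) (l2_nonneg _))
  rw [mul_pow]
  exact h1.trans (mul_le_mul_of_nonneg_right h2 (sq_nonneg _))

end Walk

/-- The least k with Rη^k ≤ ρ. Minimality keeps the rescaled frequency above ρη, and the last clause
bounds k in terms of log R / log η⁻¹. -/
lemma exists_pow_scale {R ρ η : ℝ} (hR : ρ ≤ R) (hρ : 0 < ρ) (hη0 : 0 < η) (hη1 : η < 1) :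
    ∃ k : ℕ, R * η ^ k ≤ ρ ∧ ρ * η ≤ R * η ^ k ∧ (k = 0 ∨ ρ * (η⁻¹) ^ (k - 1) < R) := by
  have hR0 : 0 < R := hρ.trans_le hR
  have hex : ∃ k : ℕ, R * η ^ k ≤ ρ := by
    obtain ⟨k, hk⟩ := exists_pow_lt_of_lt_one (div_pos hρ hR0) hη1
    rw [lt_div_iff₀ hR0] at hk
    exact ⟨k, by linarith⟩
  classical
  refine ⟨Nat.find hex, Nat.find_spec hex, ?_, ?_⟩
  · rcases Nat.eq_zero_or_pos (Nat.find hex) with h0 | h0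
    · rw [h0, pow_zero, mul_one]
      nlinarith
    · have := Nat.find_min hex (Nat.sub_lt h0 one_pos)
      rw [not_le] at this
      rw [← Nat.sub_add_cancel (Nat.one_le_iff_ne_zero.2 h0.ne'), pow_succ, ← mul_assoc]
      exact mul_le_mul_of_nonneg_right this.le hη0.le
  · rcases Nat.eq_zero_or_pos (Nat.find hex) with h0 | h0
    · exact Or.inl h0
    · right
      have := Nat.find_min hex (Nat.sub_lt h0 one_pos)
      rw [not_le] at this
      rw [inv_pow, ← div_eq_mul_inv, div_lt_iff₀ (by positivity)]
      exact this

/-- Here η⁻¹ ≥ √y, while log R and log ρ⁻¹ are each at most (log y)²/8, so k - 1 ≤ (log y)/2. The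
loss 4^k is then polynomial in y, which explains the frequency range e^{(log y)²/8}. -/
lemma four_pow_le_of_scale {y R ρ η : ℝ} {k : ℕ} (hρ : 0 < ρ) (hy : 40 ≤ y) (hη0 : 0 < η)
    (hη : η ≤ 2 * Real.pi / y) (hRy : R ≤ Real.exp (Real.log y ^ 2 / 8))
    (hlog : 8 * Real.log ρ⁻¹ ≤ Real.log y ^ 2) (hk : k = 0 ∨ ρ * (η⁻¹) ^ (k - 1) < R) :
    (4 : ℝ) ^ k ≤ 4 * y := by
  rcases hk with rfl | hk
  · simp; linarith
  have hy0 : 0 < y := by linarith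
  have hly : 0 < Real.log y := Real.log_pos (by linarith)
  have hyη : Real.log y / 2 ≤ Real.log η⁻¹ := by
    have h1 : y / (2 * Real.pi) ≤ η⁻¹ := by
      rw [← inv_div]; exact inv_anti₀ hη0 hη
    have h2 : Real.log (Real.sqrt y) ≤ Real.log η⁻¹ := by
      refine Real.log_le_log (Real.sqrt_pos.2 hy0) (le_trans ?_ h1)
      rw [le_div_iff₀ Real.two_pi_pos]
      -- This uses 4π² < 40 ≤ y.
      have h3 : 2 * Real.pi ≤ Real.sqrt y := by
        refine Real.le_sqrt_of_sq_le ?_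
        nlinarith [Real.pi_lt_d2, Real.pi_pos]
      calc Real.sqrt y * (2 * Real.pi) ≤ Real.sqrt y * Real.sqrt y := by gcongr
        _ = y := Real.mul_self_sqrt hy0.le
    rwa [Real.log_sqrt hy0.le] at h2
  have h4 : Real.log ρ + (k - 1 : ℕ) * Real.log η⁻¹ ≤ Real.log y ^ 2 / 8 := by
    rw [← Real.log_pow, ← Real.log_mul hρ.ne' (by positivity),
      Real.log_le_iff_le_exp (by positivity)]
    exact (hk.le.trans hRy)
  rw [Real.log_inv] at hlog
  have h5 : ((k - 1 : ℕ) : ℝ) * (Real.log y / 2) ≤ (Real.log y / 2) * (Real.log y / 2) := by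
    have := mul_le_mul_of_nonneg_left hyη (Nat.cast_nonneg (α := ℝ) (k - 1))
    nlinarith
  have h6 : ((k - 1 : ℕ) : ℝ) ≤ Real.log y / 2 := le_of_mul_le_mul_right h5 (by linarith)
  have h7 : (4 : ℝ) ^ (k - 1) ≤ y := by
    have hl4 : Real.log 4 ≤ 2 := by
      rw [show (4 : ℝ) = 2 ^ 2 by norm_num, Real.log_pow]
      have := Real.log_two_lt_d9
      push_cast
      linarith
    rw [← Real.log_le_log_iff (by positivity) hy0, Real.log_pow]
    have : 0 ≤ Real.log 4 := Real.log_nonneg (by norm_num)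
    nlinarith [Nat.cast_nonneg (α := ℝ) (k - 1)]
  calc (4 : ℝ) ^ k ≤ 4 ^ (k - 1 + 1) := pow_le_pow_right₀ (by norm_num) (by omega)
    _ = 4 * 4 ^ (k - 1) := pow_succ' _ _
    _ ≤ 4 * y := by linarith

section Walk

variable {ι : Type*} [Fintype ι] {p : ι → ℝ} {θ : ι → Ang} {b : ι → ℂ}

/-- Power counting, up to constants: the denominator is at most y⁶ and η² at least y^{-2M}, so the
gap is at least y^{-2M-6}; there are at least y^{8M+30} blocks. The product y^{6M+24} exceeds the
claim by y^{2M+8}, of which one factor y absorbs the constants. -/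
lemma high_gap_bound {y cD c η : ℝ} {M k q N : ℕ} {x ρ : ℝ} (hy : 40 ≤ y) (hcD : 0 < cD)
    (hc : 0 < c) (hρ : 0 < ρ)
    (hq : (q : ℝ) ≤ 2 * y) (hη : cD ≤ η * q ^ M) (hη0 : 0 < η) (hk4 : (4 : ℝ) ^ k ≤ 4 * y)
    (hx : ρ * η ≤ x)
    (hN : (N : ℝ) = y ^ (8 * M + 32))
    (hyc : 22 * (16 * 121) * 2 ^ (2 * M) / (c * ρ ^ 2 * cD ^ 2) ≤ y) :
    y ^ (4 * M + 16) ≤ c * x ^ 2 / (4 ^ k * (k + 1) * (k * q + 3) ^ 2) * (N / (k * q + 3) : ℕ) := by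
  have hy1 : 1 ≤ y := by linarith
  have hy0 : 0 < y := by linarith
  have hkq : (k : ℝ) + 1 ≤ 4 * y := by
    have h1 : k + 1 ≤ 4 ^ k := Nat.lt_pow_self (by norm_num)
    have h2 : ((k : ℝ) + 1) ≤ 4 ^ k := by exact_mod_cast h1
    linarith
  have hℓ : (k : ℝ) * q + 3 ≤ 11 * y ^ 2 := by
    have : (k : ℝ) * q ≤ 4 * y * (2 * y) :=
      mul_le_mul (by linarith) hq (Nat.cast_nonneg _) (by positivity)
    nlinarith
  have hℓ0 : (0 : ℝ) < k * q + 3 := by positivity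
  have hden : (4 : ℝ) ^ k * (k + 1) * (k * q + 3) ^ 2 ≤ 16 * 121 * y ^ 6 := by
    calc (4 : ℝ) ^ k * (k + 1) * (k * q + 3) ^ 2 ≤ (4 * y) * (4 * y) * (11 * y ^ 2) ^ 2 := by
          gcongr
      _ = _ := by ring
  have hηlow : cD ^ 2 ≤ η ^ 2 * (2 ^ (2 * M) * y ^ (2 * M)) := by
    have h1 : cD ≤ η * (2 * y) ^ M := hη.trans (by gcongr)
    calc cD ^ 2 ≤ (η * (2 * y) ^ M) ^ 2 := pow_le_pow_left₀ hcD.le h1 2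
      _ = _ := by ring
  have hfl : y ^ (8 * M + 30) / 22 ≤ ((N / (k * q + 3) : ℕ) : ℝ) := by
    have h1 : N < (k * q + 3) * (N / (k * q + 3) + 1) := Nat.lt_mul_div_succ N (by positivity)
    have h2 : (N : ℝ) < (k * q + 3) * ((N / (k * q + 3) : ℕ) + 1) := by exact_mod_cast h1
    have h3 : y ^ 2 * y ^ (8 * M + 30) < 11 * y ^ 2 * ((N / (k * q + 3) : ℕ) + 1) := by
      rw [← pow_add, show 2 + (8 * M + 30) = 8 * M + 32 by ring, ← hN]
      exact h2.trans_le (by gcongr)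
    have h4 : y ^ (8 * M + 30) < 11 * ((N / (k * q + 3) : ℕ) + 1) := by
      have : 0 < y ^ 2 := by positivity
      nlinarith
    have h5 : 22 ≤ y ^ (8 * M + 30) := by
      have := le_self_pow₀ hy1 (show 8 * M + 30 ≠ 0 by omega)
      linarith
    linarith
  have hx2 : ρ ^ 2 * η ^ 2 ≤ x ^ 2 := by
    rw [← mul_pow]; exact pow_le_pow_left₀ (by positivity) hx 2
  rw [div_le_iff₀ (by positivity)] at hyc
  have hδ : c * (ρ ^ 2 * η ^ 2) / (16 * 121 * y ^ 6)
      ≤ c * x ^ 2 / (4 ^ k * (k + 1) * (k * q + 3) ^ 2) := by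
    gcongr
  refine le_trans ?_ (mul_le_mul hδ hfl (by positivity) (by positivity))
  rw [div_mul_div_comm, le_div_iff₀ (by positivity)]
  have e1 : y ^ (8 * M + 30) = y ^ (4 * M + 16) * y ^ (2 * M) * y ^ 6 * y ^ (2 * M + 8) := by
    rw [← pow_add, ← pow_add, ← pow_add]; congr 1; ring
  have h8 : y ≤ y ^ (2 * M + 8) := le_self_pow₀ hy1 (by omega)
  have key : 22 * (16 * 121) ≤ c * ρ ^ 2 * η ^ 2 * y ^ (2 * M) * y ^ (2 * M + 8) := by
    have h2M : (0 : ℝ) < 2 ^ (2 * M) := by positivity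
    have a1 : 22 * (16 * 121) * 2 ^ (2 * M) * cD ^ 2
        ≤ y * (c * ρ ^ 2 * cD ^ 2) * (η ^ 2 * (2 ^ (2 * M) * y ^ (2 * M))) :=
      mul_le_mul hyc hηlow (by positivity) (by positivity)
    have a2 : 22 * (16 * 121) * (2 ^ (2 * M) * cD ^ 2)
        ≤ (c * ρ ^ 2 * η ^ 2 * y ^ (2 * M) * y) * (2 ^ (2 * M) * cD ^ 2) := by linarith
    have a3 := le_of_mul_le_mul_right a2 (by positivity)
    exact a3.trans (by gcongr)
  rw [e1]
  have := mul_le_mul_of_nonneg_left key (by positivity : 0 ≤ y ^ (4 * M + 16) * y ^ 6)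
  linarith

/-- Given y, Dirichlet's theorem at ⌈y⌉ supplies the step q, and `exists_pow_scale` the number k of
differences adapted to R. -/
lemma GapData.exists_high_decay {α : ℝ} {i₁ i₂ : ι} {M : ℕ} (h : GapData p θ b α i₁ i₂ M) {ρ : ℝ}
    (hρ : 0 < ρ) {c : ℝ} (hc : 0 < c) (hgap : ∀ R : ℝ, 0 ≤ R → ∀ k q : ℕ,
      R * ‖unitAt (α : Ang) ^ q - 1‖ ^ k ≤ ρ → ∀ F,
      c * (R * ‖unitAt (α : Ang) ^ q - 1‖ ^ k) ^ 2 / (4 ^ k * (k + 1) * (k * q + 3) ^ 2) * l2 F ^ 2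
        ≤ l2 F ^ 2 - l2 ((avgOp p θ b R ^ (k * q + 3)) F) ^ 2) :
    ∃ y₀ : ℝ, ∀ y, y₀ ≤ y → ∀ N : ℕ, (N : ℝ) = y ^ (8 * M + 32) →
      ∀ R : ℝ, ρ ≤ R → R ≤ Real.exp (Real.log y ^ 2 / 8) → ∀ F,
      l2 ((avgOp p θ b R ^ N) F) ^ 2 ≤ Real.exp (-y ^ (4 * M + 16)) * l2 F ^ 2 := by
  obtain ⟨cD, hcD, hD⟩ := h.dioph
  refine ⟨max 40 (max (Real.exp (8 * |Real.log ρ⁻¹| + 1))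
    (22 * (16 * 121) * 2 ^ (2 * M) / (c * ρ ^ 2 * cD ^ 2))), fun y hy N hN R hρR hRy F => ?_⟩
  have hy40 : 40 ≤ y := (le_max_left _ _).trans hy
  have hy1 : Real.exp (8 * |Real.log ρ⁻¹| + 1) ≤ y :=
    ((le_max_left _ _).trans (le_max_right _ _)).trans hy
  have hyc := ((le_max_right _ _).trans (le_max_right _ _)).trans hy
  have hy0 : 0 < y := by linarith
  have hlog : 8 * Real.log ρ⁻¹ ≤ Real.log y ^ 2 := by
    have h1 : 8 * |Real.log ρ⁻¹| + 1 ≤ Real.log y := (Real.le_log_iff_exp_le hy0).2 hy1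
    nlinarith [abs_nonneg (Real.log ρ⁻¹), le_abs_self (Real.log ρ⁻¹)]
  have hQ0 : 0 < ⌈y⌉₊ := Nat.ceil_pos.2 hy0
  obtain ⟨q, hq0, hqQ, hq⟩ := exists_norm_unitAt_pow_sub_one_le α hQ0
  have hη0 := norm_pow_sub_one_pos_of_lower_bound hcD hD hq0
  have hηy : ‖unitAt (α : Ang) ^ q - 1‖ ≤ 2 * Real.pi / y := by
    refine hq.trans ?_
    have := Real.two_pi_pos
    gcongr
    exact Nat.le_ceil y
  have hη1 : ‖unitAt (α : Ang) ^ q - 1‖ < 1 := by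
    refine hηy.trans_lt ?_
    rw [div_lt_one hy0]
    linarith [Real.pi_lt_d2]
  obtain ⟨k, hk1, hk2, hk3⟩ := exists_pow_scale hρR hρ hη0 hη1
  have hk4 := four_pow_le_of_scale hρ hy40 hη0 hηy hRy hlog hk3
  have hq2 : (q : ℝ) ≤ 2 * y := by
    have h1 : (q : ℝ) ≤ ⌈y⌉₊ := by exact_mod_cast hqQ
    linarith [Nat.ceil_lt_add_one hy0.le]
  have hb := high_gap_bound hy40 hcD hc hρ hq2 (hD q hq0) hη0 hk4 hk2 hN hyc
  have hd := l2_avgOp_pow_sq_le_exp (fun i => (h.pos i).le) h.sum_eq_one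
    (hgap R (hρ.le.trans hρR) k q hk1) N F
  refine hd.trans (mul_le_mul_of_nonneg_right (Real.exp_le_exp.2 ?_) (sq_nonneg _))
  linarith

end Walk

/-! ### Low frequencies -/

lemma norm_phase_sub_taylor_le {y Y : ℝ} (hy : |y| ≤ Y) :
    ‖phase y - (1 + y * Complex.I - (y ^ 2 / 2 : ℝ))‖ ≤ |y| ^ 3 * Real.exp Y := by
  have h := Complex.norm_exp_sub_sum_le_norm_mul_exp (y * Complex.I) 3
  have h2 : ∑ m ∈ Finset.range 3, (y * Complex.I : ℂ) ^ m / m.factorial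
      = 1 + y * Complex.I - (y ^ 2 / 2 : ℝ) := by
    simp [Finset.sum_range_succ, mul_pow]
    ring
  have h3 : ‖(y * Complex.I : ℂ)‖ = |y| := by simp
  rw [h2, h3] at h
  exact h.trans (by gcongr)

/-- The double-angle formula: the constant part produces the variance, and the second harmonic is
what `corr` must cancel. -/
lemma inner_sq_unitAt (b : ℂ) (x : Ang) :
    inner ℝ b (unitAt x) ^ 2 = ‖b‖ ^ 2 / 2 + (unitAt x ^ 2 * conj (b ^ 2)).re / 2 := by
  have h := norm_unitAt x
  set u := unitAt x
  have h1 : u.re ^ 2 + u.im ^ 2 = 1 := by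
    have := Complex.normSq_eq_norm_sq u
    rw [h, Complex.normSq_apply] at this
    linarith
  rw [Complex.inner, ← Complex.normSq_eq_norm_sq, Complex.normSq_apply]
  simp [pow_two]
  linear_combination ((b.re * b.re + b.im * b.im) / 2) * h1

section Walk

variable {ι : Type*} [Fintype ι] {p : ι → ℝ} {θ : ι → Ang} {b : ι → ℂ}

/-- The second order correction to the constant function, an approximate eigenfunction of the
averaging operator at low frequencies being `1 + corr`. -/
noncomputable def corr (A : ℂ) (R : ℝ) : C(Ang, ℂ) :=
  ⟨fun x => ((2 * R ^ 2 * (A * unitAt x ^ 2).re : ℝ) : ℂ), by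
    have h1 := continuous_unitAt
    have h3 : Continuous fun v : Ang => (A * unitAt v ^ 2).re :=
      Complex.continuous_re.comp (by fun_prop)
    fun_prop⟩

lemma corr_apply (A : ℂ) (R : ℝ) (x : Ang) :
    corr A R x = ((2 * R ^ 2 * (A * unitAt x ^ 2).re : ℝ) : ℂ) := rfl

lemma norm_corr_le (A : ℂ) (R : ℝ) (x : Ang) : ‖corr A R x‖ ≤ 2 * ‖A‖ * R ^ 2 := by
  rw [corr_apply, Complex.norm_real, Real.norm_eq_abs, abs_mul, abs_of_nonneg (by positivity)]
  have h : |(A * unitAt x ^ 2).re| ≤ ‖A‖ := by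
    refine (Complex.abs_re_le_norm _).trans (le_of_eq ?_)
    rw [norm_mul, norm_pow, norm_unitAt]; simp
  nlinarith [sq_nonneg R]

lemma sum_inner_eq_zero (hmean : ∑ i, (p i : ℂ) * b i = 0) (u : ℂ) :
    ∑ i, p i * inner ℝ (b i) u = 0 := by
  have h : ∑ i, p i * inner ℝ (b i) u = inner ℝ (∑ i, (p i : ℂ) * b i) u := by
    rw [sum_inner]
    refine Finset.sum_congr rfl fun i _ => ?_
    rw [← Complex.real_smul, real_inner_smul_left]
  rw [h, hmean, inner_zero_left]

/-- The equation for A makes the change of the correction under averaged rotation exactly opposite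
to the second harmonic in `sum_taylor`. -/
lemma sum_corr {A : ℂ}
    (hA : 8 * A * (conj (∑ i, (p i : ℂ) * unitAt (θ i) ^ 2) - 1)
      = conj (∑ i, (p i : ℂ) * b i ^ 2)) (R : ℝ) (x : Ang) :
    ∑ i, (p i : ℂ) * corr A R (x - θ i) = corr A R x
      + ((R ^ 2 / 4 * (unitAt x ^ 2 * conj (∑ i, (p i : ℂ) * b i ^ 2)).re : ℝ) : ℂ) := by
  have h1 : ∀ i, (p i : ℂ) * corr A R (x - θ i)
      = ((2 * R ^ 2 * (A * unitAt x ^ 2 * conj ((p i : ℂ) * unitAt (θ i) ^ 2)).re : ℝ) : ℂ) := by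
    intro i
    rw [corr_apply, sub_eq_add_neg, unitAt_add, unitAt_neg, ← Complex.ofReal_mul]
    congr 1
    have : A * unitAt x ^ 2 * conj ((p i : ℂ) * unitAt (θ i) ^ 2)
        = (p i : ℂ) * (A * (unitAt x * conj (unitAt (θ i))) ^ 2) := by
      rw [map_mul, map_pow, Complex.conj_ofReal]; ring
    rw [this, Complex.re_ofReal_mul]
    ring
  simp_rw [h1, corr_apply]
  rw [← Complex.ofReal_sum, ← Finset.mul_sum, ← Complex.re_sum, ← Finset.mul_sum, ← map_sum,
    ← Complex.ofReal_add, ← hA]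
  congr 1
  set L := conj (∑ i, (p i : ℂ) * unitAt (θ i) ^ 2)
  have h2 : unitAt x ^ 2 * (8 * A * (L - 1))
      = ((8 : ℝ) : ℂ) * (A * unitAt x ^ 2 * L) - ((8 : ℝ) : ℂ) * (A * unitAt x ^ 2) := by
    push_cast; ring
  rw [h2, Complex.sub_re, Complex.re_ofReal_mul, Complex.re_ofReal_mul]
  ring

lemma sum_taylor (hp1 : ∑ i, p i = 1) (hmean : ∑ i, (p i : ℂ) * b i = 0) {v : ℝ}
    (hv : v = 1 / 2 * ∑ i, p i * ‖b i‖ ^ 2) (R : ℝ) (x : Ang) :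
    ∑ i, (p i : ℂ) * (1 + (R * inner ℝ (b i) (unitAt x) : ℝ) * Complex.I
        - ((R * inner ℝ (b i) (unitAt x)) ^ 2 / 2 : ℝ))
      = 1 - ((v * R ^ 2 / 2 : ℝ) : ℂ)
        - ((R ^ 2 / 4 * (unitAt x ^ 2 * conj (∑ i, (p i : ℂ) * b i ^ 2)).re : ℝ) : ℂ) := by
  have h1 : ∀ i, (p i : ℂ) * (1 + (R * inner ℝ (b i) (unitAt x) : ℝ) * Complex.I
        - ((R * inner ℝ (b i) (unitAt x)) ^ 2 / 2 : ℝ))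
      = (p i : ℂ) + ((R * (p i * inner ℝ (b i) (unitAt x)) : ℝ) : ℂ) * Complex.I
        - ((R ^ 2 / 4 * (p i * ‖b i‖ ^ 2) : ℝ) : ℂ)
        - ((R ^ 2 / 4 * (unitAt x ^ 2 * conj ((p i : ℂ) * b i ^ 2)).re : ℝ) : ℂ) := by
    intro i
    have h2 : unitAt x ^ 2 * conj ((p i : ℂ) * b i ^ 2)
        = (p i : ℂ) * (unitAt x ^ 2 * conj (b i ^ 2)) := by
      rw [map_mul, Complex.conj_ofReal]; ring
    rw [h2, Complex.re_ofReal_mul, mul_pow, inner_sq_unitAt]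
    push_cast
    ring
  simp_rw [h1, Finset.sum_sub_distrib, Finset.sum_add_distrib, ← Finset.sum_mul,
    ← Complex.ofReal_sum, ← Finset.mul_sum, ← Complex.re_sum, ← Finset.mul_sum, ← map_sum, hp1,
    sum_inner_eq_zero hmean]
  rw [hv]
  push_cast
  ring

lemma norm_sum_mul_le (hp : ∀ i, 0 ≤ p i) (hp1 : ∑ i, p i = 1) {z : ι → ℂ} {C : ℝ}
    (hz : ∀ i, ‖z i‖ ≤ C) : ‖∑ i, (p i : ℂ) * z i‖ ≤ C := by
  refine (norm_sum_le _ _).trans ?_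
  calc ∑ i, ‖(p i : ℂ) * z i‖ ≤ ∑ i, p i * C := by
        refine Finset.sum_le_sum fun i _ => ?_
        rw [norm_mul, Complex.norm_real, Real.norm_eq_abs, abs_of_nonneg (hp i)]
        exact mul_le_mul_of_nonneg_left (hz i) (hp i)
    _ = C := by rw [← Finset.sum_mul, hp1, one_mul]

/-- The first-order term vanishes by mean zero, the isotropic second-order term matches the
expansion of e^{-vR²/2}, and the second harmonic is cancelled by `corr`. The condition on the
averaged squared rotations makes the equation for A solvable. -/
lemma exists_approx_eigenfunction (hp : ∀ i, 0 ≤ p i) (hp1 : ∑ i, p i = 1)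
    (hmean : ∑ i, (p i : ℂ) * b i = 0) {v : ℝ} (hv : v = 1 / 2 * ∑ i, p i * ‖b i‖ ^ 2)
    (hlam : ∑ i, (p i : ℂ) * unitAt (θ i) ^ 2 ≠ 1) {ρ : ℝ} (hρ : 0 < ρ) :
    ∃ A : ℂ, ∃ C : ℝ, 0 < C ∧ ∀ R : ℝ, 0 ≤ R → R ≤ ρ → ∀ x,
      ‖(avgOp p θ b R (1 + corr A R) - (Real.exp (-(v * R ^ 2 / 2)) : ℂ) • (1 + corr A R)) x‖
        ≤ C * R ^ 3 := by
  set L := ∑ i, (p i : ℂ) * unitAt (θ i) ^ 2 with hL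
  have hL1 : conj L - 1 ≠ 0 := by
    intro h
    apply hlam
    rw [sub_eq_zero] at h
    have := congrArg conj h
    simpa using this
  set A := conj (∑ i, (p i : ℂ) * b i ^ 2) / (8 * (conj L - 1)) with hA
  have hA' : 8 * A * (conj L - 1) = conj (∑ i, (p i : ℂ) * b i ^ 2) := by
    rw [hA]; field_simp
  set Y := ∑ i, ‖b i‖ with hY
  have hY0 : 0 ≤ Y := Finset.sum_nonneg fun i _ => norm_nonneg _
  have hbY : ∀ i, ‖b i‖ ≤ Y := fun i =>
    Finset.single_le_sum (f := fun i => ‖b i‖) (fun i _ => norm_nonneg _) (Finset.mem_univ i)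
  have hv0 : 0 ≤ v := by
    rw [hv]
    exact mul_nonneg (by norm_num) (Finset.sum_nonneg fun i _ => mul_nonneg (hp i) (sq_nonneg _))
  refine ⟨A, Y ^ 3 * Real.exp (Y * ρ) + 2 * ‖A‖ * Y + v ^ 2 * ρ + 2 * ‖A‖ * v * ρ + 1,
    by positivity, fun R hR hRρ x => ?_⟩
  set s := v * R ^ 2 / 2 with hs
  have hs0 : 0 ≤ s := by positivity
  set y : ι → ℝ := fun i => R * inner ℝ (b i) (unitAt x) with hy
  have hyb : ∀ i, |y i| ≤ Y * R := by
    intro i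
    rw [hy, abs_mul, abs_of_nonneg hR, mul_comm]
    refine mul_le_mul_of_nonneg_right ?_ hR
    refine (abs_real_inner_le_norm _ _).trans ?_
    rw [norm_unitAt, mul_one]
    exact hbY i
  -- Four errors: Taylor remainder of the phases, phase times correction, Taylor remainder of the
  -- eigenvalue, and correction times eigenvalue defect.
  have e0 : (avgOp p θ b R (1 + corr A R) - (Real.exp (-s) : ℂ) • (1 + corr A R)) x
      = ∑ i, (p i : ℂ) * (phase (y i) - (1 + y i * Complex.I - (y i ^ 2 / 2 : ℝ)))
        + ∑ i, (p i : ℂ) * ((phase (y i) - 1) * corr A R (x - θ i))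
        + ((1 - s - Real.exp (-s) : ℝ) : ℂ) + corr A R x * ((1 - Real.exp (-s) : ℝ) : ℂ) := by
    have t1 := sum_corr hA' R x
    have t2 := sum_taylor hp1 hmean hv R x
    simp only [ContinuousMap.sub_apply, ContinuousMap.smul_apply, ContinuousMap.add_apply,
      ContinuousMap.one_apply, avgOp_apply]
    have t3 : ∑ i, (p i : ℂ) * (phase (y i) * (1 + corr A R (x - θ i)))
        = ∑ i, (p i : ℂ) * (phase (y i) - (1 + y i * Complex.I - (y i ^ 2 / 2 : ℝ)))
          + ∑ i, (p i : ℂ) * ((phase (y i) - 1) * corr A R (x - θ i))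
          + ∑ i, (p i : ℂ) * (1 + y i * Complex.I - (y i ^ 2 / 2 : ℝ))
          + ∑ i, (p i : ℂ) * corr A R (x - θ i) := by
      simp_rw [← Finset.sum_add_distrib]
      refine Finset.sum_congr rfl fun i _ => ?_
      ring
    rw [t3, t1, t2, ← hs]
    simp only [smul_eq_mul]
    push_cast
    ring
  have b1 : ‖∑ i, (p i : ℂ) * (phase (y i) - (1 + y i * Complex.I - (y i ^ 2 / 2 : ℝ)))‖
      ≤ Y ^ 3 * Real.exp (Y * ρ) * R ^ 3 := by
    refine norm_sum_mul_le hp hp1 fun i => ?_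
    refine (norm_phase_sub_taylor_le ((hyb i).trans (mul_le_mul_of_nonneg_left hRρ hY0))).trans ?_
    calc |y i| ^ 3 * Real.exp (Y * ρ) ≤ (Y * R) ^ 3 * Real.exp (Y * ρ) := by
          gcongr; exact hyb i
      _ = _ := by ring
  have b2 : ‖∑ i, (p i : ℂ) * ((phase (y i) - 1) * corr A R (x - θ i))‖
      ≤ 2 * ‖A‖ * Y * R ^ 3 := by
    refine norm_sum_mul_le hp hp1 fun i => ?_
    rw [norm_mul]
    calc ‖phase (y i) - 1‖ * ‖corr A R (x - θ i)‖ ≤ (Y * R) * (2 * ‖A‖ * R ^ 2) :=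
          mul_le_mul ((norm_phase_sub_one_le _).trans (hyb i)) (norm_corr_le _ _ _)
            (norm_nonneg _) (by positivity)
      _ = _ := by ring
  have x1 : 1 - s ≤ Real.exp (-s) := by linarith [Real.add_one_le_exp (-s)]
  have x2 : Real.exp (-s) ≤ 1 := Real.exp_le_one_iff.2 (by linarith)
  have x3 : Real.exp (-s) ≤ 1 - s + s ^ 2 := by
    have h1 : Real.exp (-s) * (1 + s) ≤ 1 := by
      have := mul_le_mul_of_nonneg_left (Real.add_one_le_exp s) (Real.exp_pos (-s)).le
      rw [← Real.exp_add, neg_add_cancel, Real.exp_zero] at this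
      linarith
    have h2 : (1 : ℝ) ≤ (1 - s + s ^ 2) * (1 + s) := by nlinarith [pow_nonneg hs0 3]
    exact le_of_mul_le_mul_right (h1.trans h2) (by linarith)
  have hR4 : R ^ 4 ≤ ρ * R ^ 3 := by
    rw [pow_succ' R 3]; gcongr
  have b3 : ‖((1 - s - Real.exp (-s) : ℝ) : ℂ)‖ ≤ v ^ 2 * ρ * R ^ 3 := by
    rw [Complex.norm_real, Real.norm_eq_abs, abs_le]
    have h1 : s ^ 2 ≤ v ^ 2 * ρ * R ^ 3 := by
      rw [hs]
      have := mul_le_mul_of_nonneg_left hR4 (sq_nonneg v)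
      have h0 : 0 ≤ v ^ 2 * R ^ 4 := by positivity
      nlinarith
    constructor <;> linarith [sq_nonneg s]
  have b4 : ‖corr A R x * ((1 - Real.exp (-s) : ℝ) : ℂ)‖ ≤ 2 * ‖A‖ * v * ρ * R ^ 3 := by
    rw [norm_mul, Complex.norm_real, Real.norm_eq_abs, abs_of_nonneg (by linarith)]
    calc ‖corr A R x‖ * (1 - Real.exp (-s)) ≤ (2 * ‖A‖ * R ^ 2) * (v * R ^ 2) :=
          mul_le_mul (norm_corr_le _ _ _) (by rw [hs] at *; nlinarith [mul_nonneg hv0 (sq_nonneg R)])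
            (by linarith) (by positivity)
      _ = 2 * ‖A‖ * v * R ^ 4 := by ring
      _ ≤ 2 * ‖A‖ * v * (ρ * R ^ 3) := by gcongr
      _ = _ := by ring
  rw [e0]
  refine (norm_add_le _ _).trans ((add_le_add ((norm_add_le _ _).trans
    (add_le_add ((norm_add_le _ _).trans (add_le_add b1 b2)) b3)) b4).trans ?_)
  nlinarith [pow_nonneg hR 3]

/-- Telescoping: N terms T^{N-1-j} λ^j (Tw - λw), in which the powers of T and of λ = e^{-s} both
decay at least at rate cR² per step. -/
lemma l2_avgOp_pow_sub_le {R s c C ε : ℝ} {w : C(Ang, ℂ)} (hC : 0 ≤ C) (hε : 0 ≤ ε)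
    (hcs : c * R ^ 2 ≤ s)
    (hdec : ∀ (N : ℕ) F, l2 ((avgOp p θ b R ^ N) F) ≤ C * Real.exp (-c * N * R ^ 2) * l2 F)
    (hw : l2 (avgOp p θ b R w - (Real.exp (-s) : ℂ) • w) ≤ ε) (N : ℕ) :
    l2 ((avgOp p θ b R ^ N) w - (Real.exp (-s) : ℂ) ^ N • w)
      ≤ N * (C * Real.exp (-c * (N - 1) * R ^ 2) * ε) := by
  induction N with
  | zero => simp [l2]
  | succ N ih =>
    set T := avgOp p θ b R
    have h1 : (T ^ (N + 1)) w - (Real.exp (-s) : ℂ) ^ (N + 1) • w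
        = (T ^ N) (T w - (Real.exp (-s) : ℂ) • w)
          + (Real.exp (-s) : ℂ) • ((T ^ N) w - (Real.exp (-s) : ℂ) ^ N • w) := by
      rw [pow_succ, Module.End.mul_apply, map_sub, map_smul, smul_sub, smul_smul, ← pow_succ']
      abel
    rw [h1]
    refine (l2_add_le _ _).trans ?_
    rw [l2_smul, Complex.norm_real, Real.norm_eq_abs, abs_of_pos (Real.exp_pos _)]
    have h2 : l2 ((T ^ N) (T w - (Real.exp (-s) : ℂ) • w)) ≤ C * Real.exp (-c * N * R ^ 2) * ε :=
      (hdec N _).trans (mul_le_mul_of_nonneg_left hw (by positivity))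
    have h3 : Real.exp (-s) * (N * (C * Real.exp (-c * (N - 1) * R ^ 2) * ε))
        ≤ N * (C * Real.exp (-c * N * R ^ 2) * ε) := by
      have : Real.exp (-s) * Real.exp (-c * (N - 1) * R ^ 2) ≤ Real.exp (-c * N * R ^ 2) := by
        rw [← Real.exp_add, Real.exp_le_exp]; linarith
      calc _ = N * (C * (Real.exp (-s) * Real.exp (-c * (N - 1) * R ^ 2)) * ε) := by ring
        _ ≤ _ := by gcongr
    have h4 := mul_le_mul_of_nonneg_left ih (Real.exp_pos (-s)).le
    rw [Nat.cast_succ, add_sub_cancel_right]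
    linarith

/-- The term NR³ comes from telescoping with the approximate eigenfunction, and R² from exchanging 1
for 1 + `corr` before and after the iteration. -/
lemma exists_low_approx (hp : ∀ i, 0 ≤ p i) (hp1 : ∑ i, p i = 1)
    (hmean : ∑ i, (p i : ℂ) * b i = 0) {v : ℝ} (hv : v = 1 / 2 * ∑ i, p i * ‖b i‖ ^ 2)
    (hv0 : 0 < v)
    (hlam : ∑ i, (p i : ℂ) * unitAt (θ i) ^ 2 ≠ 1) {ρ : ℝ} (hρ : 0 < ρ)
    (hdec : ∃ C > 0, ∃ c > 0, ∀ R : ℝ, 0 ≤ R → R ≤ ρ → ∀ (N : ℕ) F,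
      l2 ((avgOp p θ b R ^ N) F) ≤ C * Real.exp (-c * N * R ^ 2) * l2 F) :
    ∃ C > 0, ∃ c > 0, ∀ R : ℝ, 0 ≤ R → R ≤ ρ → ∀ N : ℕ,
      l2 ((avgOp p θ b R ^ N) 1 - (Real.exp (-(v * N * R ^ 2 / 2)) : ℂ) • 1)
        ≤ C * (N * R ^ 3 + R ^ 2) * Real.exp (-c * N * R ^ 2) := by
  obtain ⟨C₁, hC₁, c₁, hc₁, hdec⟩ := hdec
  obtain ⟨A, C₂, hC₂, hA⟩ := exists_approx_eigenfunction hp hp1 hmean hv hlam hρ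
  set c := min c₁ (v / 2) with hc
  have hc0 : 0 < c := lt_min hc₁ (by linarith)
  set K := Real.sqrt (2 * Real.pi) with hK
  have hK0 : 0 < K := Real.sqrt_pos.2 Real.two_pi_pos
  refine ⟨C₁ * Real.exp (c * ρ ^ 2) * (K * C₂) + C₁ * (K * (2 * ‖A‖)) + K * (2 * ‖A‖),
    by positivity, c, hc0, fun R hR hRρ N => ?_⟩
  set T := avgOp p θ b R
  set s := v * R ^ 2 / 2 with hs
  have hdec' : ∀ (N : ℕ) F, l2 ((T ^ N) F) ≤ C₁ * Real.exp (-c * N * R ^ 2) * l2 F := by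
    intro N F
    refine (hdec R hR hRρ N F).trans ?_
    refine mul_le_mul_of_nonneg_right ?_ (l2_nonneg _)
    have : c * N * R ^ 2 ≤ c₁ * N * R ^ 2 := by gcongr; exact min_le_left _ _
    exact mul_le_mul_of_nonneg_left (Real.exp_le_exp.2 (by linarith)) hC₁.le
  have hcs : c * R ^ 2 ≤ s := by
    have : c * R ^ 2 ≤ v / 2 * R ^ 2 := by gcongr; exact min_le_right _ _
    rw [hs]; linarith
  have h1 := l2_avgOp_pow_sub_le (w := 1 + corr A R) (ε := K * (C₂ * R ^ 3)) hC₁.le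
    (by positivity) hcs hdec' (l2_le_of_norm_le (hA R hR hRρ)) N
  have hcorr : l2 (corr A R) ≤ K * (2 * ‖A‖ * R ^ 2) := l2_le_of_norm_le (norm_corr_le A R)
  have h2 := (hdec' N (corr A R)).trans (mul_le_mul_of_nonneg_left hcorr (by positivity))
  have hexp : (Real.exp (-(v * N * R ^ 2 / 2)) : ℂ) = (Real.exp (-s) : ℂ) ^ N := by
    rw [← Complex.ofReal_pow, ← Real.exp_nat_mul]
    congr 2
    rw [hs]; ring
  have hexp2 : Real.exp (-s) ^ N ≤ Real.exp (-c * N * R ^ 2) := by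
    rw [← Real.exp_nat_mul, Real.exp_le_exp]
    have := mul_le_mul_of_nonneg_left hcs (Nat.cast_nonneg (α := ℝ) N)
    linarith
  have h3 : l2 ((Real.exp (-s) : ℂ) ^ N • corr A R)
      ≤ Real.exp (-c * N * R ^ 2) * (K * (2 * ‖A‖ * R ^ 2)) := by
    rw [l2_smul, norm_pow, Complex.norm_real, Real.norm_eq_abs, abs_of_pos (Real.exp_pos _)]
    exact mul_le_mul hexp2 hcorr (l2_nonneg _) (Real.exp_pos _).le
  have e1 : (T ^ N) 1 - (Real.exp (-(v * N * R ^ 2 / 2)) : ℂ) • (1 : C(Ang, ℂ))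
      = ((T ^ N) (1 + corr A R) - (Real.exp (-s) : ℂ) ^ N • (1 + corr A R))
        - (T ^ N) (corr A R) + (Real.exp (-s) : ℂ) ^ N • corr A R := by
    rw [hexp, map_add, smul_add]; abel
  have h4 : Real.exp (-c * (N - 1) * R ^ 2)
      ≤ Real.exp (c * ρ ^ 2) * Real.exp (-c * N * R ^ 2) := by
    rw [← Real.exp_add, Real.exp_le_exp]
    have : c * R ^ 2 ≤ c * ρ ^ 2 := by gcongr
    linarith
  have h5 : N * (C₁ * Real.exp (-c * (N - 1) * R ^ 2) * (K * (C₂ * R ^ 3)))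
      ≤ N * (C₁ * (Real.exp (c * ρ ^ 2) * Real.exp (-c * N * R ^ 2)) * (K * (C₂ * R ^ 3))) := by
    gcongr
  rw [e1]
  refine (l2_add_le _ _).trans ((add_le_add ((l2_sub_le _ _).trans
    (add_le_add (h1.trans h5) h2)) h3).trans ?_)
  set E := Real.exp (-c * N * R ^ 2)
  have hE : 0 < E := Real.exp_pos _
  have q1 : 0 ≤ C₁ * Real.exp (c * ρ ^ 2) * (K * C₂) * R ^ 2 * E := by positivity
  have q2 : 0 ≤ (C₁ * (K * (2 * ‖A‖)) + K * (2 * ‖A‖)) * (N * R ^ 3) * E := by positivity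
  linarith

end Walk

/-! ### A bound for all frequencies -/

lemma exists_pow_mul_exp_le {c : ℝ} (hc : 0 < c) (n : ℕ) :
    ∃ C > 0, ∀ t : ℝ, 0 ≤ t → (1 + t) ^ n * Real.exp (-c * t) ≤ C := by
  refine ⟨n.factorial / c ^ n * Real.exp c, by positivity, fun t ht => ?_⟩
  have h := Real.pow_div_factorial_le_exp (c * (1 + t)) (by positivity) n
  rw [div_le_iff₀ (by positivity), mul_pow] at h
  have h2 : (1 + t) ^ n ≤ n.factorial / c ^ n * (Real.exp c * Real.exp (c * t)) := by
    rw [← Real.exp_add, div_mul_eq_mul_div, le_div_iff₀ (by positivity)]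
    rw [show c + c * t = c * (1 + t) by ring]
    linarith
  calc (1 + t) ^ n * Real.exp (-c * t)
      ≤ n.factorial / c ^ n * (Real.exp c * Real.exp (c * t)) * Real.exp (-c * t) := by gcongr
    _ = n.factorial / c ^ n * Real.exp c * (Real.exp (c * t) * Real.exp (-c * t)) := by ring
    _ = _ := by rw [← Real.exp_add]; simp

section Walk

variable {ι : Type*} [Fintype ι] {p : ι → ℝ} {θ : ι → Ang} {b : ι → ℂ}

/-- In terms of t = NR² this is a polynomial against e^{-ct}. The majorant, common to all frequency
ranges, has integral of order N^{-3/2} over R > 0. -/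
lemma low_radial_bound {C c ρ : ℝ} (hC : 0 < C) (hc : 0 < c) (hρ : 0 < ρ) :
    ∃ C' > 0, ∀ (R : ℝ) (N : ℕ), 0 < R → R ≤ ρ → 0 < N →
      R * (C * (N * R ^ 3 + R ^ 2) * Real.exp (-c * N * R ^ 2)) ≤ C' / (N * (1 + N * R ^ 2)) := by
  obtain ⟨K, hK, hKb⟩ := exists_pow_mul_exp_le hc 3
  refine ⟨C * (1 + ρ) * K, by positivity, fun R N hR hRρ hN => ?_⟩
  have hN' : (0 : ℝ) < N := by exact_mod_cast hN
  rw [le_div_iff₀ (by positivity)]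
  set t := N * R ^ 2 with ht
  have ht0 : 0 ≤ t := by positivity
  have h1 := hKb t ht0
  have e1 : R * (C * (N * R ^ 3 + R ^ 2) * Real.exp (-c * N * R ^ 2)) * (N * (1 + t))
      = C * (t ^ 2 + R * t) * (1 + t) * Real.exp (-c * t) := by
    rw [ht, show -c * N * R ^ 2 = -c * (N * R ^ 2) by ring]; ring
  have h2 : t ^ 2 + R * t ≤ (1 + ρ) * (1 + t) ^ 2 := by
    nlinarith [mul_le_mul_of_nonneg_right hRρ ht0, mul_nonneg hρ.le ht0, mul_nonneg hρ.le (sq_nonneg t)]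
  rw [e1]
  calc C * (t ^ 2 + R * t) * (1 + t) * Real.exp (-c * t)
      ≤ C * ((1 + ρ) * (1 + t) ^ 2) * (1 + t) * Real.exp (-c * t) := by gcongr
    _ = C * (1 + ρ) * ((1 + t) ^ 3 * Real.exp (-c * t)) := by ring
    _ ≤ _ := by gcongr

lemma gaussian_radial_bound {v ρ : ℝ} (hv : 0 < v) (hρ : 0 < ρ) :
    ∃ C' > 0, ∀ (R : ℝ) (N : ℕ), ρ ≤ R → 0 < N →
      R * Real.exp (-(v * N * R ^ 2 / 2)) ≤ C' / (N * (1 + N * R ^ 2)) := by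
  obtain ⟨K, hK, hKb⟩ := exists_pow_mul_exp_le (half_pos hv) 2
  refine ⟨K / ρ, by positivity, fun R N hR hN => ?_⟩
  have hN' : (0 : ℝ) < N := by exact_mod_cast hN
  have hR0 : 0 < R := hρ.trans_le hR
  rw [le_div_iff₀ (by positivity), le_div_iff₀ hρ]
  set t := N * R ^ 2 with ht
  have ht0 : 0 ≤ t := by positivity
  have h1 := hKb t ht0
  rw [show -(v * N * R ^ 2 / 2) = -(v / 2) * t by rw [ht]; ring]
  calc R * Real.exp (-(v / 2) * t) * (N * (1 + t)) * ρ
      ≤ R * Real.exp (-(v / 2) * t) * (N * (1 + t)) * R := by gcongr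
    _ = t * (1 + t) * Real.exp (-(v / 2) * t) := by rw [ht]; ring
    _ ≤ (1 + t) ^ 2 * Real.exp (-(v / 2) * t) := by gcongr; nlinarith
    _ ≤ K := h1

lemma middle_radial_bound {y R : ℝ} {M N : ℕ} (hy : Real.exp (32 * (8 * M + 32)) ≤ y)
    (hN : (N : ℝ) = y ^ (8 * M + 32)) (hR : 0 < R) (hRy : R ≤ Real.exp (Real.log y ^ 2 / 8)) :
    R * Real.exp (-y ^ (4 * M + 16) / 2) ≤ 2 / (N * (1 + N * R ^ 2)) := by
  have hy32 : 32 * (8 * M + 32) + 1 ≤ y := (Real.add_one_le_exp _).trans hy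
  have hM : (0 : ℝ) ≤ M := Nat.cast_nonneg _
  have hy1 : 1 ≤ y := by nlinarith
  have hy0 : 0 < y := by linarith
  have hN1 : (1 : ℝ) ≤ N := by rw [hN]; exact one_le_pow₀ hy1
  set X := Real.exp (Real.log y ^ 2 / 8) with hX
  have hX1 : 1 ≤ X := Real.one_le_exp (by positivity)
  have hXpos : 0 < X := by linarith
  have hl0 : 0 ≤ Real.log y := Real.log_nonneg hy1
  have hly : Real.log y ≤ y := by linarith [Real.log_le_sub_one_of_pos hy0]
  have hNexp : (N : ℝ) ^ 2 = Real.exp (2 * (8 * M + 32) * Real.log y) := by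
    rw [hN, ← pow_mul, ← Real.exp_log (pow_pos hy0 _), Real.log_pow]
    congr 1
    push_cast
    ring
  have key : X ^ 3 * N ^ 2 * Real.exp (-y ^ (4 * M + 16) / 2) ≤ 1 := by
    rw [hNexp, hX, ← Real.exp_nat_mul, ← Real.exp_add, ← Real.exp_add, Real.exp_le_one_iff]
    have h16 : y ^ 3 ≤ y ^ (4 * M + 16) := pow_le_pow_right₀ hy1 (by omega)
    have h1 : Real.log y ^ 2 ≤ y ^ 2 := by gcongr
    have h2 : 2 * (8 * M + 32) * Real.log y ≤ y * y := by
      refine mul_le_mul (by linarith) hly hl0 hy0.le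
    have h3 : 4 * y ^ 2 ≤ y ^ 3 := by nlinarith [sq_nonneg y]
    push_cast
    nlinarith
  rw [le_div_iff₀ (by positivity)]
  have h1 : (1 : ℝ) + N * R ^ 2 ≤ 2 * (N * X ^ 2) := by
    have : (N : ℝ) * R ^ 2 ≤ N * X ^ 2 := by gcongr
    have : 1 ≤ (N : ℝ) * X ^ 2 := by nlinarith
    linarith
  calc R * Real.exp (-y ^ (4 * M + 16) / 2) * (N * (1 + N * R ^ 2))
      ≤ X * Real.exp (-y ^ (4 * M + 16) / 2) * (N * (2 * (N * X ^ 2))) := by gcongr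
    _ = 2 * (X ^ 3 * N ^ 2 * Real.exp (-y ^ (4 * M + 16) / 2)) := by ring
    _ ≤ 2 := by linarith

/-- Only the kernel's decay is used here: δ⁴R ≥ e^{(log y)²/16} ≥ N², as log y is at least 32 times
the exponent of y in N. -/
lemma far_radial_bound {y R δ : ℝ} {M N : ℕ} (hy : Real.exp (32 * (8 * M + 32)) ≤ y)
    (hN : (N : ℝ) = y ^ (8 * M + 32)) (hδ : Real.exp (-(Real.log y ^ 2 / 64)) ≤ δ)
    (hRy : Real.exp (Real.log y ^ 2 / 8) ≤ R) :
    R * (1 / (1 + δ * R) ^ 4) ≤ 2 / (N * (1 + N * R ^ 2)) := by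
  have hM : (0 : ℝ) ≤ M := Nat.cast_nonneg _
  have hy1 : 1 ≤ y := (Real.one_le_exp (by positivity)).trans hy
  have hy0 : 0 < y := by linarith
  have hlog : 32 * (8 * M + 32) ≤ Real.log y := (Real.le_log_iff_exp_le hy0).2 hy
  have hN1 : (1 : ℝ) ≤ N := by rw [hN]; exact one_le_pow₀ hy1
  have hR1 : 1 ≤ R := (Real.one_le_exp (by positivity)).trans hRy
  have hδ0 : 0 < δ := (Real.exp_pos _).trans_le hδ
  have hNexp : (N : ℝ) ^ 2 = Real.exp (2 * (8 * M + 32) * Real.log y) := by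
    rw [hN, ← pow_mul, ← Real.exp_log (pow_pos hy0 _), Real.log_pow]
    congr 1
    push_cast
    ring
  have key : (N : ℝ) ^ 2 ≤ δ ^ 4 * R := by
    calc (N : ℝ) ^ 2 ≤ Real.exp (-(Real.log y ^ 2 / 64)) ^ 4 * Real.exp (Real.log y ^ 2 / 8) := by
          rw [hNexp, ← Real.exp_nat_mul, ← Real.exp_add, Real.exp_le_exp]
          push_cast
          nlinarith
      _ ≤ δ ^ 4 * R := by gcongr
  rw [mul_one_div, div_le_div_iff₀ (by positivity) (by positivity)]
  have h1 : (1 : ℝ) + N * R ^ 2 ≤ 2 * (N * R ^ 2) := by nlinarith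
  calc R * (N * (1 + N * R ^ 2)) ≤ R * (N * (2 * (N * R ^ 2))) := by gcongr
    _ = 2 * (R ^ 3 * N ^ 2) := by ring
    _ ≤ 2 * (R ^ 3 * (δ ^ 4 * R)) := by gcongr
    _ = 2 * (δ * R) ^ 4 := by ring
    _ ≤ 2 * (1 + δ * R) ^ 4 := by gcongr; linarith

theorem GapData.exists_radial_bound {α : ℝ} {i₁ i₂ : ι} {M : ℕ} (h : GapData p θ b α i₁ i₂ M)
    (hmean : ∑ i, (p i : ℂ) * b i = 0) {v : ℝ} (hv : v = 1 / 2 * ∑ i, p i * ‖b i‖ ^ 2)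
    (hv0 : 0 < v) (hlam : ∑ i, (p i : ℂ) * unitAt (θ i) ^ 2 ≠ 1) :
    ∃ C > 0, ∃ y₀ : ℝ, ∀ y, y₀ ≤ y → ∀ N : ℕ, (N : ℝ) = y ^ (8 * M + 32) →
      ∀ δ, Real.exp (-(Real.log y ^ 2 / 64)) ≤ δ → ∀ R, 0 < R →
        R * (l2 ((avgOp p θ b R ^ N) 1 - (Real.exp (-(v * N * R ^ 2 / 2)) : ℂ) • 1)
          * (1 / (1 + δ * R) ^ 4)) ≤ C / (N * (1 + N * R ^ 2)) := by
  have hp : ∀ i, 0 ≤ p i := fun i => (h.pos i).le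
  obtain ⟨c, hc, ρ, hρ, hgap⟩ := h.exists_gap
  -- The gap with k = q = 0, so three steps and denominator 3² = 9.
  have hlow := h.exists_low_decay (ρ := ρ) ⟨c / 9, by positivity, fun R hR hRρ F => by
    have := hgap R hR 0 0 (by simpa using hRρ) F
    norm_num at this
    linarith⟩
  obtain ⟨C₁, hC₁, c₁, hc₁, hlow⟩ := exists_low_approx hp h.sum_eq_one hmean hv hv0 hlam hρ hlow
  obtain ⟨y₀, hhigh⟩ := h.exists_high_decay hρ hc hgap
  obtain ⟨C₂, hC₂, hb2⟩ := low_radial_bound hC₁ hc₁ hρ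
  obtain ⟨C₃, hC₃, hb3⟩ := gaussian_radial_bound hv0 hρ
  set K := Real.sqrt (2 * Real.pi) with hK
  have hK0 : 0 < K := Real.sqrt_pos.2 Real.two_pi_pos
  have hl1 : l2 1 ≤ K := by
    have := l2_le_of_norm_le (F := 1) (M := 1) (fun x => by simp)
    rwa [mul_one] at this
  refine ⟨C₂ + K * (2 + C₃), by positivity, max y₀ (Real.exp (32 * (8 * M + 32))),
    fun y hy N hN δ hδ R hR => ?_⟩
  have hyM := (le_max_right _ _).trans hy
  have hy0 : 0 < y := (Real.exp_pos _).trans_le hyM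
  have hN0 : 0 < N := by
    have : (0 : ℝ) < N := by rw [hN]; positivity
    exact_mod_cast this
  have hδ0 : 0 < δ := (Real.exp_pos _).trans_le hδ
  have hW1 : 1 / (1 + δ * R) ^ 4 ≤ 1 := by
    rw [div_le_one (by positivity)]
    exact one_le_pow₀ (by nlinarith)
  have hW0 : 0 ≤ 1 / (1 + δ * R) ^ 4 := by positivity
  set F := (avgOp p θ b R ^ N) 1 - (Real.exp (-(v * N * R ^ 2 / 2)) : ℂ) • (1 : C(Ang, ℂ)) with hF
  set W := 1 / (1 + δ * R) ^ 4 with hW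
  have hden : (0 : ℝ) < N * (1 + N * R ^ 2) := by positivity
  by_cases hRρ : R ≤ ρ
  · calc R * (l2 F * W) ≤ R * (l2 F * 1) := by gcongr; exact l2_nonneg _
      _ ≤ R * (C₁ * (N * R ^ 3 + R ^ 2) * Real.exp (-c₁ * N * R ^ 2)) := by
        rw [mul_one]; gcongr; exact hlow R hR.le hRρ N
      _ ≤ C₂ / (N * (1 + N * R ^ 2)) := hb2 R N hR hRρ hN0
      _ ≤ _ := by gcongr; nlinarith
  · have hRρ' : ρ ≤ R := (not_le.1 hRρ).le
    have hFle : l2 F ≤ l2 ((avgOp p θ b R ^ N) 1) + Real.exp (-(v * N * R ^ 2 / 2)) * K := by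
      refine (l2_sub_le _ _).trans ?_
      rw [l2_smul, Complex.norm_real, Real.norm_eq_abs, abs_of_pos (Real.exp_pos _)]
      gcongr
    have hmain : R * (l2 ((avgOp p θ b R ^ N) 1) * W) ≤ K * (2 / (N * (1 + N * R ^ 2))) := by
      by_cases hRX : R ≤ Real.exp (Real.log y ^ 2 / 8)
      · have h1 := hhigh y ((le_max_left _ _).trans hy) N hN R hRρ' hRX 1
        have h2 : l2 ((avgOp p θ b R ^ N) 1) ≤ Real.exp (-y ^ (4 * M + 16) / 2) * K := by
          refine le_of_sq_le_sq ?_ (by positivity)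
          rw [mul_pow, ← Real.exp_nat_mul]
          refine h1.trans ?_
          have : ((2 : ℕ) : ℝ) * (-y ^ (4 * M + 16) / 2) = -y ^ (4 * M + 16) := by
            push_cast; ring
          rw [this]
          gcongr
          exact l2_nonneg _
        calc R * (l2 ((avgOp p θ b R ^ N) 1) * W)
            ≤ R * (Real.exp (-y ^ (4 * M + 16) / 2) * K * 1) := by gcongr
          _ = K * (R * Real.exp (-y ^ (4 * M + 16) / 2)) := by ring
          _ ≤ _ := by gcongr; exact middle_radial_bound hyM hN hR hRX
      · have h1 : l2 ((avgOp p θ b R ^ N) 1) ≤ K :=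
          (l2_avgOp_pow_le hp h.sum_eq_one R N 1).trans hl1
        calc R * (l2 ((avgOp p θ b R ^ N) 1) * W) ≤ R * (K * W) := by gcongr
          _ = K * (R * W) := by ring
          _ ≤ _ := by gcongr; exact far_radial_bound hyM hN hδ (not_le.1 hRX).le
    have hg : R * (Real.exp (-(v * N * R ^ 2 / 2)) * K * W)
        ≤ K * (C₃ / (N * (1 + N * R ^ 2))) := by
      calc R * (Real.exp (-(v * N * R ^ 2 / 2)) * K * W)
          ≤ R * (Real.exp (-(v * N * R ^ 2 / 2)) * K * 1) := by gcongr
        _ = K * (R * Real.exp (-(v * N * R ^ 2 / 2))) := by ring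
        _ ≤ _ := by gcongr; exact hb3 R N hRρ' hN0
    calc R * (l2 F * W)
        ≤ R * ((l2 ((avgOp p θ b R ^ N) 1) + Real.exp (-(v * N * R ^ 2 / 2)) * K) * W) := by gcongr
      _ = R * (l2 ((avgOp p θ b R ^ N) 1) * W) + R * (Real.exp (-(v * N * R ^ 2 / 2)) * K * W) := by
        ring
      _ ≤ K * (2 / (N * (1 + N * R ^ 2))) + K * (C₃ / (N * (1 + N * R ^ 2))) := add_le_add hmain hg
      _ = (K * (2 + C₃)) / (N * (1 + N * R ^ 2)) := by ring
      _ ≤ _ := by gcongr; linarith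

end Walk

/-! ### Integration in polar coordinates -/

/-- The volume on `Ang` has total mass 2π, so no normalising factor appears. -/
lemma lintegral_eq_lintegral_polar {f : ℂ → ℝ≥0∞} (hf : Measurable f) :
    ∫⁻ z, f z = ∫⁻ R in Set.Ioi (0 : ℝ), ENNReal.ofReal R * ∫⁻ x : Ang, f (R * unitAt x) := by
  rw [← Complex.lintegral_comp_polarCoord_symm f, polarCoord_target, Measure.volume_eq_prod,
    ← Measure.prod_restrict, lintegral_prod]
  · refine lintegral_congr fun R => ?_
    simp only [Complex.polarCoord_symm_apply, smul_eq_mul]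
    have hm : Measurable fun ψ : ℝ => f (R * (Real.cos ψ + Real.sin ψ * Complex.I)) :=
      hf.comp (by fun_prop)
    rw [lintegral_const_mul _ hm]
    congr 1
    have hmp := AddCircle.measurePreserving_mk (2 * Real.pi) (-Real.pi)
    have hg : Measurable fun x : Ang => f (R * unitAt x) :=
      hf.comp (continuous_const.mul continuous_unitAt).measurable
    rw [← hmp.lintegral_comp hg, show -Real.pi + 2 * Real.pi = Real.pi by ring,
      ← restrict_Ioo_eq_restrict_Ioc]
    refine lintegral_congr fun ψ => ?_
    have : unitAt (QuotientAddGroup.mk ψ : Ang) = Real.cos ψ + Real.sin ψ * Complex.I := by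
      have := unitAt_coe ψ
      rw [Complex.exp_mul_I] at this
      exact_mod_cast this
    rw [this]
  · refine Measurable.aemeasurable ?_
    simp only [Complex.polarCoord_symm_apply, smul_eq_mul]
    exact (ENNReal.measurable_ofReal.comp measurable_fst).mul (hf.comp (by fun_prop))

lemma lintegral_inv_one_add_mul_sq_le {C : ℝ} (hC : 0 ≤ C) {N : ℝ} (hN : 0 < N) :
    ∫⁻ R in Set.Ioi (0 : ℝ), ENNReal.ofReal (C / (N * (1 + N * R ^ 2)))
      ≤ ENNReal.ofReal (C * Real.pi / (N * Real.sqrt N)) := by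
  have hs : 0 < Real.sqrt N := Real.sqrt_pos.2 hN
  have e : ∀ R : ℝ, C / (N * (1 + N * R ^ 2)) = C / N * (1 + (Real.sqrt N * R) ^ 2)⁻¹ := by
    intro R
    rw [mul_pow, Real.sq_sqrt hN.le, ← div_eq_mul_inv, div_div]
  have hInt : Integrable fun R : ℝ => C / N * (1 + (Real.sqrt N * R) ^ 2)⁻¹ :=
    (integrable_inv_one_add_sq.comp_mul_left' hs.ne').const_mul _
  calc ∫⁻ R in Set.Ioi (0 : ℝ), ENNReal.ofReal (C / (N * (1 + N * R ^ 2)))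
      ≤ ∫⁻ R : ℝ, ENNReal.ofReal (C / (N * (1 + N * R ^ 2))) := setLIntegral_le_lintegral _ _
    _ = ENNReal.ofReal (∫ R : ℝ, C / N * (1 + (Real.sqrt N * R) ^ 2)⁻¹) := by
        simp_rw [e]
        rw [ofReal_integral_eq_lintegral_ofReal hInt]
        exact .of_forall fun R => by positivity
    _ = _ := by
        rw [integral_const_mul, Measure.integral_comp_mul_left (fun x : ℝ => (1 + x ^ 2)⁻¹),
          integral_univ_inv_one_add_sq, abs_of_pos (inv_pos.2 hs)]
        congr 1
        simp only [smul_eq_mul]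
        field_simp

lemma lintegral_ofReal_norm_le (F : C(Ang, ℂ)) :
    ∫⁻ x, ENNReal.ofReal ‖F x‖ ≤ ENNReal.ofReal (Real.sqrt (2 * Real.pi) * l2 F) := by
  rw [← ofReal_integral_eq_lintegral_ofReal (integrable_of_continuous (by fun_prop))
    (.of_forall fun x => norm_nonneg _)]
  exact ENNReal.ofReal_le_ofReal (integral_norm_le_l2 F)

/-- A radial bound for the `L²` norms over circles gives a bound for a weighted integral. -/
lemma integral_le_of_radial_bound {φ : ℂ → ℂ} (hφ : Continuous φ) {F : ℝ → C(Ang, ℂ)}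
    (hF : ∀ R : ℝ, 0 < R → ∀ x, φ (R * unitAt x) = F R x) {C N δ : ℝ} (hC : 0 ≤ C) (hN : 0 < N)
    (hδ : 0 < δ)
    (hb : ∀ R, 0 < R → R * (l2 (F R) * (1 / (1 + δ * R) ^ 4)) ≤ C / (N * (1 + N * R ^ 2))) :
    ∫ z, ‖φ z‖ * (1 / (1 + δ * ‖z‖) ^ 4)
      ≤ Real.sqrt (2 * Real.pi) * C * Real.pi / (N * Real.sqrt N) := by
  have hpos : ∀ z : ℂ, (1 + δ * ‖z‖) ^ 4 ≠ 0 := fun z => by positivity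
  have hcont : Continuous fun z => ‖φ z‖ * (1 / (1 + δ * ‖z‖) ^ 4) := by
    fun_prop (disch := exact fun z => hpos z)
  rw [integral_eq_lintegral_of_nonneg_ae (.of_forall fun z => by positivity)
    hcont.aestronglyMeasurable]
  refine ENNReal.toReal_le_of_le_ofReal (by positivity) ?_
  rw [lintegral_eq_lintegral_polar (hcont.measurable.ennreal_ofReal)]
  refine le_trans ?_ (lintegral_inv_one_add_mul_sq_le (by positivity) hN)
  refine setLIntegral_mono' measurableSet_Ioi fun R hR => ?_
  have hR : 0 < R := hR
  have h1 : ∀ x : Ang, ‖(R : ℂ) * unitAt x‖ = R := fun x => by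
    rw [norm_mul, norm_unitAt, Complex.norm_real, Real.norm_eq_abs, abs_of_pos hR, mul_one]
  have h2 : ∀ x : Ang, ENNReal.ofReal (‖φ (R * unitAt x)‖ * (1 / (1 + δ * ‖(R : ℂ) * unitAt x‖) ^ 4))
      = ENNReal.ofReal ‖F R x‖ * ENNReal.ofReal (1 / (1 + δ * R) ^ 4) := fun x => by
    rw [h1, hF R hR, ENNReal.ofReal_mul (norm_nonneg _)]
  simp_rw [h2]
  have hFm : Measurable fun x => ENNReal.ofReal ‖F R x‖ :=
    (map_continuous (F R)).norm.measurable.ennreal_ofReal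
  rw [lintegral_mul_const _ hFm]
  calc ENNReal.ofReal R * ((∫⁻ x, ENNReal.ofReal ‖F R x‖) * ENNReal.ofReal (1 / (1 + δ * R) ^ 4))
      ≤ ENNReal.ofReal R * (ENNReal.ofReal (Real.sqrt (2 * Real.pi) * l2 (F R))
          * ENNReal.ofReal (1 / (1 + δ * R) ^ 4)) := by
        gcongr; exact lintegral_ofReal_norm_le _
    _ = ENNReal.ofReal (Real.sqrt (2 * Real.pi) * (R * (l2 (F R) * (1 / (1 + δ * R) ^ 4)))) := by
        have := l2_nonneg (F R)
        rw [← ENNReal.ofReal_mul (by positivity), ← ENNReal.ofReal_mul (by positivity)]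
        congr 1
        ring
    _ ≤ ENNReal.ofReal (Real.sqrt (2 * Real.pi) * C / (N * (1 + N * R ^ 2))) := by
        refine ENNReal.ofReal_le_ofReal ?_
        rw [mul_div_assoc]
        exact mul_le_mul_of_nonneg_left (hb R hR) (Real.sqrt_nonneg _)

/-! ### The density of the standard Gaussian -/

lemma gaussianReal_zero_one_le_volume : gaussianReal 0 1 ≤ (volume : Measure ℝ) := by
  rw [gaussianReal_of_var_ne_zero 0 one_ne_zero]
  calc volume.withDensity (gaussianPDF 0 1) ≤ volume.withDensity 1 := by
        refine withDensity_mono (.of_forall fun x => ?_)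
        simp only [gaussianPDF, gaussianPDFReal_def, Pi.one_apply]
        rw [ENNReal.ofReal_le_one]
        have h1 : (Real.sqrt (2 * Real.pi * ((1 : NNReal) : ℝ)))⁻¹ ≤ 1 := by
          refine inv_le_one_of_one_le₀ (Real.one_le_sqrt.2 ?_)
          have := Real.pi_gt_three
          push_cast
          linarith
        have h2 : Real.exp (-(x - 0) ^ 2 / (2 * ((1 : NNReal) : ℝ))) ≤ 1 := by
          rw [Real.exp_le_one_iff]
          push_cast
          nlinarith [sq_nonneg x]
        calc _ ≤ (1 : ℝ) * 1 := mul_le_mul h1 h2 (Real.exp_pos _).le zero_le_one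
          _ = 1 := one_mul 1
    _ = volume := withDensity_one

/-- The Gaussian is a product of two real Gaussians with density at most 1. The crude constant
suffices, since only the order 1/s² of the density after scaling matters. -/
lemma stdGaussian_complex_le_volume : stdGaussian ℂ ≤ (volume : Measure ℂ) := by
  have h1 := stdGaussian_eq_map_pi_orthonormalBasis Complex.orthonormalBasisOneI
  have hmp := (measurePreserving_finTwoArrow (gaussianReal 0 1)).symm
  have hv := Complex.volume_preserving_equiv_real_prod.symm
  have h2 : stdGaussian ℂ = ((gaussianReal 0 1).prod (gaussianReal 0 1)).map
      Complex.measurableEquivRealProd.symm := by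
    rw [h1, ← hmp.map_eq, Measure.map_map (by fun_prop) (MeasurableEquiv.measurable _)]
    congr 1
    ext x
    simp [MeasurableEquiv.finTwoArrow, Complex.measurableEquivRealProd]
    exact (Complex.equivRealProdCLM_symm_apply x).symm
  rw [h2, ← hv.map_eq]
  refine Measure.map_mono ?_ (MeasurableEquiv.measurable _)
  rw [Measure.volume_eq_prod]
  exact Measure.prod_mono gaussianReal_zero_one_le_volume gaussianReal_zero_one_le_volume

/-! ### Smoothing -/

/-- A smooth probability density on the plane supported in the unit ball. -/
noncomputable def kern (x : ℂ) : ℝ :=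
  (⟨1 / 2, 1, by norm_num, by norm_num⟩ : ContDiffBump (0 : ℂ)).normed volume x

lemma kern_nonneg (x : ℂ) : 0 ≤ kern x := ContDiffBump.nonneg_normed _ x

lemma continuous_kern : Continuous kern := ContDiffBump.continuous_normed _

lemma integrable_kern : Integrable kern := ContDiffBump.integrable_normed _

lemma integral_kern : ∫ x, kern x = 1 := ContDiffBump.integral_normed _

lemma kern_eq_zero {x : ℂ} (hx : 1 ≤ ‖x‖) : kern x = 0 := by
  have h : x ∉ Function.support kern := by
    have := ContDiffBump.support_normed_eq (μ := (volume : Measure ℂ))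
      (⟨1 / 2, 1, by norm_num, by norm_num⟩ : ContDiffBump (0 : ℂ))
    change Function.support kern = _ at this
    rw [this, mem_ball_zero_iff]
    exact not_lt.2 hx
  simpa using h

lemma exists_kern_le : ∃ K, ∀ x, kern x ≤ K := by
  have hc : HasCompactSupport kern := ContDiffBump.hasCompactSupport_normed _
  obtain ⟨K, hK⟩ := hc.exists_bound_of_continuous continuous_kern
  exact ⟨K, fun x => (le_abs_self _).trans (hK x)⟩

-- Fourier inversion for the bump, a Schwartz function. Decay of order 4 makes the weight integrable
-- on the plane and is what `far_radial_bound` needs.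
open FourierTransform in
lemma exists_kern_eq_integral : ∃ g : ℂ → ℂ, Integrable g ∧ Continuous g ∧
    (∃ C > 0, ∀ w, ‖g w‖ ≤ C * (1 / (1 + ‖w‖) ^ 4)) ∧
    ∀ x, (kern x : ℂ) = ∫ w, phase (2 * Real.pi * inner ℝ w x) * g w := by
  have hc : HasCompactSupport fun x => (kern x : ℂ) :=
    (ContDiffBump.hasCompactSupport_normed _ : HasCompactSupport kern).comp_left
      Complex.ofReal_zero
  have hs : ContDiff ℝ ((⊤ : ℕ∞) : WithTop ℕ∞) fun x => (kern x : ℂ) :=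
    Complex.ofRealCLM.contDiff.comp (ContDiffBump.contDiff_normed _)
  set S : SchwartzMap ℂ ℂ := hc.toSchwartzMap hs with hS
  refine ⟨⇑(𝓕 S : SchwartzMap ℂ ℂ), (𝓕 S).integrable, (𝓕 S).continuous, ?_, fun x => ?_⟩
  · have h := fun w => SchwartzMap.one_add_le_sup_seminorm_apply (𝕜 := ℝ) (m := (4, 0)) (k := 4)
      (n := 0) le_rfl le_rfl (𝓕 S) w
    simp only [norm_iteratedFDeriv_zero] at h
    set K := 2 ^ 4 * ((Finset.Iic ((4, 0) : ℕ × ℕ)).sup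
      fun m => SchwartzMap.seminorm ℝ m.1 m.2) (𝓕 S)
    refine ⟨|K| + 1, by positivity, fun w => ?_⟩
    rw [mul_one_div, le_div_iff₀ (by positivity), mul_comm]
    exact (h w).trans (by linarith [le_abs_self K])
  · have h1 : 𝓕⁻ (𝓕 S) = S := FourierTransform.fourierInv_fourier_eq S
    have h2 : S x = kern x := rfl
    rw [← h2]
    conv_lhs => rw [← h1]
    rw [SchwartzMap.fourierInv_coe, Real.fourierInv_eq']
    rfl

section Density

variable (μ ν : Measure ℂ) [IsProbabilityMeasure μ] [IsProbabilityMeasure ν]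

lemma integral_kern_scaled {g : ℂ → ℂ} (hgi : Integrable g) (hgc : Continuous g)
    (hg : ∀ x, (kern x : ℂ) = ∫ w, phase (2 * Real.pi * inner ℝ w x) * g w) (δ : ℝ) (x : ℂ) :
    ((∫ y, kern (δ⁻¹ • (x - y)) ∂μ : ℝ) : ℂ)
      = ∫ w, g w * phase (2 * Real.pi * inner ℝ w (δ⁻¹ • x))
          * charFun μ ((-(2 * Real.pi / δ)) • w) := by
  have hph := continuous_phase
  rw [← integral_complex_ofReal]
  simp_rw [hg]
  rw [integral_integral_swap]
  · refine integral_congr_ae (.of_forall fun w => ?_)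
    simp only
    rw [charFun_apply, ← integral_const_mul]
    refine integral_congr_ae (.of_forall fun y => ?_)
    simp only
    have e : 2 * Real.pi * inner ℝ w (δ⁻¹ • (x - y))
        = 2 * Real.pi * inner ℝ w (δ⁻¹ • x) + inner ℝ y ((-(2 * Real.pi / δ)) • w) := by
      rw [smul_sub, inner_sub_right, real_inner_smul_right _ _ δ⁻¹, real_inner_smul_right _ _ δ⁻¹,
        real_inner_smul_right, real_inner_comm w y]
      ring
    rw [e, phase_add]
    simp only [phase]
    ring
  · have h1 : Integrable (fun q : ℂ × ℂ => g q.2) (μ.prod volume) := hgi.comp_snd μ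
    refine h1.mono (Continuous.aestronglyMeasurable ?_) (.of_forall fun q => ?_)
    · simp only [Function.uncurry_def]
      fun_prop
    · simp [Function.uncurry_def, norm_phase]

lemma integrable_one_div_one_add_norm_pow : Integrable fun w : ℂ => 1 / (1 + ‖w‖) ^ 4 := by
  have h := integrable_one_add_norm (E := ℂ) (μ := volume) (r := 4)
    (by rw [Complex.finrank_real_complex]; norm_num)
  refine h.congr (.of_forall fun w => ?_)
  simp only
  rw [Real.rpow_neg (by positivity), one_div]
  norm_cast

/-- Both smoothed densities are Fourier integrals of characteristic functions at -2πw/δ;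
substituting gives the Jacobian (δ/2π)² ≤ δ². The rescaled kernel has integral δ², not 1. -/
lemma exists_density_sub_le : ∃ C > 0, ∀ (μ ν : Measure ℂ) [IsProbabilityMeasure μ]
    [IsProbabilityMeasure ν] (δ : ℝ), 0 < δ → ∀ x : ℂ,
    |∫ y, kern (δ⁻¹ • (x - y)) ∂μ - ∫ y, kern (δ⁻¹ • (x - y)) ∂ν|
      ≤ C * δ ^ 2 * ∫ z, ‖charFun μ z - charFun ν z‖ * (1 / (1 + δ / (2 * Real.pi) * ‖z‖) ^ 4) := by
  obtain ⟨g, hgi, hgc, ⟨C, hC, hgC⟩, hg⟩ := exists_kern_eq_integral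
  refine ⟨C, hC, fun μ ν _ _ δ hδ x => ?_⟩
  have hp := Real.two_pi_pos
  have hph := continuous_phase
  set H : ℂ → ℝ := fun z =>
    ‖charFun μ z - charFun ν z‖ * (1 / (1 + δ / (2 * Real.pi) * ‖z‖) ^ 4) with hH
  set s : ℝ := -(2 * Real.pi / δ) with hs
  have hcμ : Continuous (charFun μ) := continuous_charFun
  have hcν : Continuous (charFun ν) := continuous_charFun
  have hInt : ∀ (μ : Measure ℂ) [IsProbabilityMeasure μ], Continuous (charFun μ) →
      Integrable fun w => g w * phase (2 * Real.pi * inner ℝ w (δ⁻¹ • x)) * charFun μ (s • w) := by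
    intro μ _ hc
    refine hgi.mono (Continuous.aestronglyMeasurable (by fun_prop)) (.of_forall fun w => ?_)
    rw [norm_mul, norm_mul, norm_phase, mul_one]
    exact mul_le_of_le_one_right (norm_nonneg _) (norm_charFun_le_one _)
  have hHs : ∀ w, H (s • w) = ‖charFun μ (s • w) - charFun ν (s • w)‖ * (1 / (1 + ‖w‖) ^ 4) := by
    intro w
    simp only [hH]
    rw [norm_smul, hs, norm_neg, Real.norm_eq_abs, abs_of_pos (by positivity), ← mul_assoc,
      div_mul_div_comm, mul_comm δ, div_self (by positivity), one_mul]
  have hHi : Integrable fun w => C * H (s • w) := by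
    refine Integrable.const_mul ?_ C
    refine (integrable_one_div_one_add_norm_pow.const_mul 2).mono
      (Continuous.aestronglyMeasurable ?_) (.of_forall fun w => ?_)
    · simp_rw [hHs]
      have : ∀ w : ℂ, (1 + ‖w‖) ^ 4 ≠ 0 := fun w => by positivity
      fun_prop (disch := exact fun w => this w)
    · rw [hHs, norm_mul, norm_mul, norm_norm]
      gcongr
      refine (norm_sub_le _ _).trans ?_
      rw [Real.norm_of_nonneg zero_le_two]
      linarith [norm_charFun_le_one (μ := μ) (s • w), norm_charFun_le_one (μ := ν) (s • w)]
  rw [← Real.norm_eq_abs, ← Complex.norm_real, Complex.ofReal_sub,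
    integral_kern_scaled μ hgi hgc hg, integral_kern_scaled ν hgi hgc hg,
    ← integral_sub (hInt μ hcμ) (hInt ν hcν)]
  refine (norm_integral_le_of_norm_le hHi (.of_forall fun w => ?_)).trans ?_
  · rw [← mul_sub, norm_mul, norm_mul, norm_phase, mul_one, hHs, mul_left_comm, mul_comm]
    gcongr
    exact hgC w
  · rw [integral_const_mul, Measure.integral_comp_smul, Complex.finrank_real_complex, smul_eq_mul,
      ← mul_assoc]
    have hH0 : 0 ≤ ∫ z, H z := integral_nonneg fun z => by simp only [hH]; positivity
    refine mul_le_mul_of_nonneg_right ?_ hH0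
    refine mul_le_mul_of_nonneg_left ?_ hC.le
    rw [hs, neg_sq, abs_of_pos (by positivity), div_pow, inv_div]
    exact div_le_self (by positivity) (one_le_pow₀ (by linarith [Real.pi_gt_three]))

lemma integral_kern_translate {δ : ℝ} (hδ : 0 < δ) (y : ℂ) :
    ∫ x, kern (δ⁻¹ • (x - y)) = δ ^ 2 := by
  rw [integral_sub_right_eq_self (fun x => kern (δ⁻¹ • x)) y, Measure.integral_comp_smul,
    Complex.finrank_real_complex, integral_kern, inv_pow, inv_inv, smul_eq_mul, mul_one,
    abs_of_pos (by positivity)]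

lemma integrable_kern_translate {δ : ℝ} (hδ : 0 < δ) (y : ℂ) :
    Integrable fun x => kern (δ⁻¹ • (x - y)) :=
  (integrable_kern.comp_smul (inv_ne_zero hδ.ne')).comp_sub_right y

lemma kern_translate_eq_zero {δ : ℝ} (hδ : 0 < δ) {x y : ℂ} (h : δ ≤ dist x y) :
    kern (δ⁻¹ • (x - y)) = 0 := by
  refine kern_eq_zero ?_
  rw [norm_smul, norm_inv, Real.norm_of_nonneg hδ.le, inv_mul_eq_div, one_le_div hδ,
    ← dist_eq_norm]
  exact h

lemma integrable_kern_prod {A : Set ℂ} (hA : volume A ≠ ∞) (δ : ℝ) :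
    Integrable (fun q : ℂ × ℂ => kern (δ⁻¹ • (q.1 - q.2))) ((volume.restrict A).prod μ) := by
  have : IsFiniteMeasure ((volume : Measure ℂ).restrict A) := ⟨by
    rw [Measure.restrict_apply_univ]; exact hA.lt_top⟩
  obtain ⟨K, hK⟩ := exists_kern_le
  have := continuous_kern
  refine (integrable_const K).mono' (Continuous.aestronglyMeasurable (by fun_prop))
    (.of_forall fun q => ?_)
  rw [Real.norm_of_nonneg (kern_nonneg _)]
  exact hK _

/-- The kernel vanishes at distance δ or more, so smoothing moves mass by less than δ. With
`le_setIntegral_density` this sandwiches masses of balls. -/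
lemma setIntegral_density_le {δ s : ℝ} (hδ : 0 < δ) (x₀ : ℂ) :
    ∫ x in Metric.ball x₀ s, ∫ y, kern (δ⁻¹ • (x - y)) ∂μ
      ≤ δ ^ 2 * μ.real (Metric.ball x₀ (s + δ)) := by
  have hi := integrable_kern_prod μ (A := Metric.ball x₀ s) measure_ball_lt_top.ne δ
  rw [integral_integral_swap hi]
  calc ∫ y, (∫ x in Metric.ball x₀ s, kern (δ⁻¹ • (x - y))) ∂μ
      ≤ ∫ y, (Metric.ball x₀ (s + δ)).indicator (fun _ => δ ^ 2) y ∂μ := by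
        refine integral_mono hi.integral_prod_right
          ((integrable_const _).indicator measurableSet_ball) fun y => ?_
        by_cases hy : y ∈ Metric.ball x₀ (s + δ)
        · rw [Set.indicator_of_mem hy, ← integral_kern_translate hδ y]
          exact setIntegral_le_integral (integrable_kern_translate hδ y)
            (.of_forall fun x => kern_nonneg _)
        · rw [Set.indicator_of_notMem hy]
          refine (setIntegral_eq_zero_of_forall_eq_zero fun x hx => ?_).le
          refine kern_translate_eq_zero hδ ?_
          rw [Metric.mem_ball] at hx hy
          have := dist_triangle_left y x₀ x
          linarith
    _ = _ := by
        rw [integral_indicator measurableSet_ball, setIntegral_const, smul_eq_mul, mul_comm]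

lemma le_setIntegral_density {δ s : ℝ} (hδ : 0 < δ) (x₀ : ℂ) :
    δ ^ 2 * μ.real (Metric.ball x₀ s)
      ≤ ∫ x in Metric.ball x₀ (s + δ), ∫ y, kern (δ⁻¹ • (x - y)) ∂μ := by
  have hi := integrable_kern_prod μ (A := Metric.ball x₀ (s + δ)) measure_ball_lt_top.ne δ
  rw [integral_integral_swap hi]
  calc δ ^ 2 * μ.real (Metric.ball x₀ s)
      = ∫ y, (Metric.ball x₀ s).indicator (fun _ => δ ^ 2) y ∂μ := by
        rw [integral_indicator measurableSet_ball, setIntegral_const, smul_eq_mul, mul_comm]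
    _ ≤ _ := by
        refine integral_mono ((integrable_const _).indicator measurableSet_ball)
          hi.integral_prod_right fun y => ?_
        by_cases hy : y ∈ Metric.ball x₀ s
        · rw [Set.indicator_of_mem hy, ← integral_kern_translate hδ y]
          refine le_of_eq (setIntegral_eq_integral_of_forall_compl_eq_zero fun x hx => ?_).symm
          refine kern_translate_eq_zero hδ ?_
          rw [Metric.mem_ball] at hx hy
          have := dist_triangle x y x₀
          linarith
        · rw [Set.indicator_of_notMem hy]
          exact setIntegral_nonneg measurableSet_ball fun x _ => kern_nonneg _

lemma setIntegral_density_sub_le {δ s K : ℝ} (x₀ : ℂ)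
    (hK : ∀ x, |∫ y, kern (δ⁻¹ • (x - y)) ∂μ - ∫ y, kern (δ⁻¹ • (x - y)) ∂ν| ≤ K) :
    |(∫ x in Metric.ball x₀ s, ∫ y, kern (δ⁻¹ • (x - y)) ∂μ)
      - ∫ x in Metric.ball x₀ s, ∫ y, kern (δ⁻¹ • (x - y)) ∂ν|
      ≤ K * (volume : Measure ℂ).real (Metric.ball x₀ s) := by
  have hμ := (integrable_kern_prod μ (A := Metric.ball x₀ s) measure_ball_lt_top.ne
    δ).integral_prod_left
  have hν := (integrable_kern_prod ν (A := Metric.ball x₀ s) measure_ball_lt_top.ne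
    δ).integral_prod_left
  rw [← integral_sub hμ hν, ← Real.norm_eq_abs]
  exact norm_setIntegral_le_of_norm_le_const measure_ball_lt_top fun x _ => hK x

end Density

lemma volume_real_ball (x : ℂ) {r : ℝ} (hr : 0 ≤ r) :
    (volume : Measure ℂ).real (Metric.ball x r) = Real.pi * r ^ 2 := by
  rw [Measure.real, Complex.volume_ball]
  simp [hr]
  ring

lemma measureReal_ball_sub_le {ν : Measure ℂ} [IsProbabilityMeasure ν] {D : ℝ} (hD : 0 ≤ D)
    (hν : ∀ A : Set ℂ, MeasurableSet A → ν A ≤ ENNReal.ofReal D * volume A) (x : ℂ) {r s : ℝ}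
    (hr : 0 ≤ r) (hrs : r ≤ s) :
    ν.real (Metric.ball x s) - ν.real (Metric.ball x r) ≤ D * (Real.pi * (s ^ 2 - r ^ 2)) := by
  have hsub := Metric.ball_subset_ball (x := x) hrs
  rw [← measureReal_sdiff hsub measurableSet_ball]
  have h1 := hν (Metric.ball x s \ Metric.ball x r) (measurableSet_ball.diff measurableSet_ball)
  have hfin : volume (Metric.ball x s \ Metric.ball x r) ≠ ∞ :=
    ((measure_mono Set.sdiff_subset).trans_lt measure_ball_lt_top).ne
  have h2 := ENNReal.toReal_mono (ENNReal.mul_ne_top ENNReal.ofReal_ne_top hfin) h1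
  rw [ENNReal.toReal_mul, ENNReal.toReal_ofReal hD] at h2
  refine h2.trans (le_of_eq ?_)
  congr 1
  change (volume : Measure ℂ).real _ = _
  rw [measureReal_sdiff hsub measurableSet_ball measure_ball_lt_top.ne, volume_real_ball x hr,
    volume_real_ball x (hr.trans hrs)]
  ring

/-- The smoothing inequality: closeness of characteristic functions controls the difference of the
masses of balls, if one of the measures has a bounded density. -/
theorem exists_smoothing : ∃ C > 0, ∀ (μ ν : Measure ℂ) [IsProbabilityMeasure μ]
    [IsProbabilityMeasure ν] (D : ℝ), 0 ≤ D →
    (∀ A : Set ℂ, MeasurableSet A → ν A ≤ ENNReal.ofReal D * volume A) →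
    ∀ (x₀ : ℂ) (r δ : ℝ), 0 < δ → 2 * δ ≤ r →
    |μ.real (Metric.ball x₀ r) - ν.real (Metric.ball x₀ r)| ≤ C * (D * (r * δ) + r ^ 2 *
      ∫ z, ‖charFun μ z - charFun ν z‖ * (1 / (1 + δ / (2 * Real.pi) * ‖z‖) ^ 4)) := by
  obtain ⟨C, hC, hdens⟩ := exists_density_sub_le
  refine ⟨4 * Real.pi * C + 8 * Real.pi, by have := Real.pi_pos; positivity,
    fun μ ν _ _ D hD hν x₀ r δ hδ hr => ?_⟩
  have hpi := Real.pi_pos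
  set J := ∫ z, ‖charFun μ z - charFun ν z‖ * (1 / (1 + δ / (2 * Real.pi) * ‖z‖) ^ 4) with hJ
  have hJ0 : 0 ≤ J := integral_nonneg fun z => by positivity
  have hr0 : 0 < r := by linarith
  have hK := hdens μ ν δ hδ
  have hδ2 : 0 < δ ^ 2 := by positivity
  -- Upper bound: from the μ-mass at radius r to the smoothed masses at r + δ, then to the ν-mass at
  -- r + 2δ. The lower bound uses r - δ and r - 2δ, whence 2δ ≤ r; the density bound controls ν on
  -- the annuli.
  have u1 := le_setIntegral_density μ (s := r) hδ x₀
  have u2 := (abs_le.1 (setIntegral_density_sub_le μ ν (s := r + δ) x₀ hK)).2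
  have u3 := setIntegral_density_le ν (s := r + δ) hδ x₀
  rw [volume_real_ball x₀ (by linarith)] at u2
  have u4 := measureReal_ball_sub_le hD hν x₀ hr0.le (by linarith : r ≤ r + δ + δ)
  have l1 := le_setIntegral_density ν (s := r - δ - δ) hδ x₀
  have l2' := (abs_le.1 (setIntegral_density_sub_le μ ν (s := r - δ) x₀ hK)).1
  have l3 := setIntegral_density_le μ (s := r - δ) hδ x₀
  rw [sub_add_cancel] at l1 l3
  rw [volume_real_ball x₀ (by linarith)] at l2'
  have l4 := measureReal_ball_sub_le hD hν x₀ (by linarith : 0 ≤ r - δ - δ)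
    (by linarith : r - δ - δ ≤ r)
  have hCJ : 0 ≤ C * J := by positivity
  have hDr : 0 ≤ D * (r * δ) := by positivity
  have hJr : 0 ≤ r ^ 2 * J := by positivity
  have up : μ.real (Metric.ball x₀ r)
      ≤ ν.real (Metric.ball x₀ (r + δ + δ)) + C * J * (Real.pi * (r + δ) ^ 2) := by
    refine le_of_mul_le_mul_left ?_ hδ2
    linarith
  have lo : ν.real (Metric.ball x₀ (r - δ - δ))
      ≤ μ.real (Metric.ball x₀ r) + C * J * (Real.pi * (r - δ) ^ 2) := by
    refine le_of_mul_le_mul_left ?_ hδ2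
    linarith
  have q1 : (r + δ) ^ 2 ≤ 4 * r ^ 2 := by nlinarith
  have q2 : (r - δ) ^ 2 ≤ 4 * r ^ 2 := by nlinarith
  have q3 : (r + δ + δ) ^ 2 - r ^ 2 ≤ 8 * (r * δ) := by nlinarith
  have q4 : r ^ 2 - (r - δ - δ) ^ 2 ≤ 8 * (r * δ) := by nlinarith
  have w1 : C * J * (Real.pi * (r + δ) ^ 2) ≤ C * J * (Real.pi * (4 * r ^ 2)) := by gcongr
  have w2 : C * J * (Real.pi * (r - δ) ^ 2) ≤ C * J * (Real.pi * (4 * r ^ 2)) := by gcongr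
  have w3 : D * (Real.pi * ((r + δ + δ) ^ 2 - r ^ 2)) ≤ D * (Real.pi * (8 * (r * δ))) := by gcongr
  have w4 : D * (Real.pi * (r ^ 2 - (r - δ - δ) ^ 2)) ≤ D * (Real.pi * (8 * (r * δ))) := by gcongr
  have z1 : 0 ≤ Real.pi * C * (D * (r * δ)) := by positivity
  have z2 : 0 ≤ Real.pi * (r ^ 2 * J) := by positivity
  rw [abs_le]
  constructor <;> linarith

/-! ### The law of the walk -/

lemma measurable_isom_apply (x : ℂ) : Measurable fun g : ℂ ≃ᵢ ℂ => g x :=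
  (measurable_pi_apply x).comp (comap_measurable fun (g : ℂ ≃ᵢ ℂ) (x : ℂ) => g x)

lemma measurable_isom_eval : Measurable fun q : (ℂ ≃ᵢ ℂ) × ℂ => q.1 q.2 := by
  have h : Measurable (Function.uncurry fun (x : ℂ) (g : ℂ ≃ᵢ ℂ) => g x) :=
    measurable_uncurry_of_continuous_of_measurable (fun g => g.continuous) measurable_isom_apply
  exact h.comp measurable_swap

/-- An isometry is determined by its values on a countable dense set. Measurable singletons allow
arbitrary functions to be integrated against Dirac masses. -/
instance isomMeasurableSingletonClass : MeasurableSingletonClass (ℂ ≃ᵢ ℂ) where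
  measurableSet_singleton g := by
    have h : ({g} : Set (ℂ ≃ᵢ ℂ))
        = ⋂ n, {g' | g' (TopologicalSpace.denseSeq ℂ n) = g (TopologicalSpace.denseSeq ℂ n)} := by
      ext g'
      simp only [Set.mem_singleton_iff, Set.mem_iInter, Set.mem_ofPred_eq]
      refine ⟨fun h n => by rw [h], fun h => IsometryEquiv.ext fun x => ?_⟩
      have := (TopologicalSpace.denseRange_denseSeq ℂ).equalizer g'.continuous g.continuous
        (funext h)
      exact congrFun this x
    rw [h]
    exact MeasurableSet.iInter fun n => measurable_isom_apply _ (measurableSet_singleton _)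

lemma walkPoint_zero (g : Fin 0 → (ℂ ≃ᵢ ℂ)) : walkPoint 0 g = 0 := by
  simp [walkPoint]

lemma walkPoint_succ (N : ℕ) (g : Fin (N + 1) → (ℂ ≃ᵢ ℂ)) :
    walkPoint (N + 1) g = g 0 (walkPoint N fun j => g j.succ) := by
  simp [walkPoint, List.ofFn_succ, IsometryEquiv.mul_apply]

lemma measurable_walkPoint (N : ℕ) : Measurable (walkPoint N) := by
  induction N with
  | zero =>
    rw [show walkPoint 0 = fun _ => 0 from funext walkPoint_zero]
    exact measurable_const
  | succ N ih =>
    rw [show walkPoint (N + 1) = fun g => g 0 (walkPoint N fun j => g j.succ) from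
      funext (walkPoint_succ N)]
    have h1 : Measurable fun g : Fin (N + 1) → (ℂ ≃ᵢ ℂ) => (g 0, walkPoint N fun j => g j.succ) :=
      (measurable_pi_apply 0).prodMk
        (ih.comp (measurable_pi_lambda _ fun j => measurable_pi_apply j.succ))
    exact measurable_isom_eval.comp h1

/-- The law of `Y_N`. -/
noncomputable def walkLaw (μ : PMF (ℂ ≃ᵢ ℂ)) (N : ℕ) : Measure ℂ :=
  (Measure.pi fun _ : Fin N => μ.toMeasure).map (walkPoint N)

instance isProbabilityMeasure_walkLaw (μ : PMF (ℂ ≃ᵢ ℂ)) (N : ℕ) :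
    IsProbabilityMeasure (walkLaw μ N) :=
  Measure.isProbabilityMeasure_map (measurable_walkPoint N).aemeasurable

lemma walkProb_eq (μ : PMF (ℂ ≃ᵢ ℂ)) (N : ℕ) {B : Set ℂ} (hB : MeasurableSet B) :
    walkProb μ N B = (walkLaw μ N).real B := by
  rw [walkProb, walkLaw, map_measureReal_apply (measurable_walkPoint N) hB]
  rfl

section FiniteSupport

variable {μ : PMF (ℂ ≃ᵢ ℂ)} {S : Finset (ℂ ≃ᵢ ℂ)}

lemma toMeasure_eq_sum (hS : ∀ g, g ∉ S → μ g = 0) :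
    μ.toMeasure = ∑ g ∈ S, μ g • Measure.dirac g := by
  ext s hs
  rw [PMF.toMeasure_apply _ hs, tsum_eq_sum (s := S) fun g hg => by
    simp [Set.indicator, hS g hg]]
  simp only [Measure.coe_finsetSum, Finset.sum_apply, Measure.smul_apply, smul_eq_mul,
    Measure.dirac_apply]
  refine Finset.sum_congr rfl fun g _ => ?_
  by_cases h : g ∈ s <;> simp [h]

lemma integral_toMeasure_eq_sum {E : Type*} [NormedAddCommGroup E] [NormedSpace ℝ E]
    [CompleteSpace E] (hS : ∀ g, g ∉ S → μ g = 0) (f : (ℂ ≃ᵢ ℂ) → E) :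
    ∫ g, f g ∂μ.toMeasure = ∑ g : S, (μ g).toReal • f g := by
  rw [toMeasure_eq_sum hS, integral_finsetSum_measure fun g _ => ?_]
  · simp_rw [integral_smul_measure, integral_dirac]
    exact (Finset.sum_coe_sort S fun g => (μ g).toReal • f g).symm
  · exact (integrable_dirac (by simp)).smul_measure (μ.apply_ne_top g)

lemma sum_toReal_eq_one (hS : ∀ g, g ∉ S → μ g = 0) : ∑ g : S, (μ g).toReal = 1 := by
  have h := integral_toMeasure_eq_sum hS fun _ => (1 : ℝ)
  simpa using h.symm

lemma charFun_walkLaw_zero (ξ : ℂ) : charFun (walkLaw μ 0) ξ = 1 := by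
  rw [walkLaw, show walkPoint 0 = fun _ => 0 from funext walkPoint_zero]
  simp [charFun_apply, Measure.map_const]

/-- Conditioning on the first letter, the outermost isometry, with the remaining N letters
independent of it. -/
lemma charFun_walkLaw_succ (hS : ∀ g, g ∉ S → μ g = 0) (N : ℕ) (ξ : ℂ) :
    charFun (walkLaw μ (N + 1)) ξ
      = ∑ g : S, ((μ g).toReal : ℂ) * ∫ w, phase (inner ℝ ((g : ℂ ≃ᵢ ℂ) w) ξ) ∂walkLaw μ N := by
  have hph := continuous_phase
  have hpm : ∀ {X : Type} [MeasurableSpace X] {f : X → ℂ}, Measurable f →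
      Measurable fun q => phase (inner ℝ (f q) ξ) := by
    intro X _ f hf
    exact (by fun_prop : Continuous fun z : ℂ => phase (inner ℝ z ξ)).measurable.comp hf
  set P := Measure.pi fun _ : Fin N => μ.toMeasure with hP
  set H : (ℂ ≃ᵢ ℂ) × (Fin N → (ℂ ≃ᵢ ℂ)) → ℂ :=
    fun q => phase (inner ℝ (q.1 (walkPoint N q.2)) ξ) with hH
  have hHm : Measurable H := hpm (measurable_isom_eval.comp
    (measurable_fst.prodMk ((measurable_walkPoint N).comp measurable_snd)))
  have hHi : Integrable H (μ.toMeasure.prod P) :=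
    (integrable_const (1 : ℝ)).mono' hHm.aestronglyMeasurable
      (.of_forall fun q => (norm_phase _).le)
  have e := measurePreserving_piFinSuccAbove (fun _ : Fin (N + 1) => μ.toMeasure) 0
  have h1 : charFun (walkLaw μ (N + 1)) ξ = ∫ q, H q ∂(μ.toMeasure.prod P) := by
    rw [charFun_apply, walkLaw, integral_map (measurable_walkPoint _).aemeasurable
      (by fun_prop)]
    rw [← e.integral_comp' H]
    refine integral_congr_ae (.of_forall fun g => ?_)
    simp only [hH, walkPoint_succ, phase]
    rfl
  rw [h1, integral_prod _ hHi, integral_toMeasure_eq_sum hS]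
  refine Finset.sum_congr rfl fun g _ => ?_
  rw [Complex.real_smul]
  congr 1
  have hg : Continuous fun w : ℂ => phase (inner ℝ ((g : ℂ ≃ᵢ ℂ) w) ξ) := by
    have := (g : ℂ ≃ᵢ ℂ).continuous
    fun_prop
  rw [walkLaw, integral_map (measurable_walkPoint _).aemeasurable hg.aestronglyMeasurable]

/-- Moving the rotation of the outermost isometry to the other side of the inner product shifts x by
-θ, and its translation contributes a phase: this is a twist. -/
lemma charFun_walkLaw (hS : ∀ g, g ∉ S → μ g = 0) {θ : S → Ang}
    (hθ : ∀ (g : S) (x : ℂ), (g : ℂ ≃ᵢ ℂ) x = unitAt (θ g) * x + (g : ℂ ≃ᵢ ℂ) 0) (N : ℕ) (R : ℝ)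
    (x : Ang) :
    charFun (walkLaw μ N) (R * unitAt x)
      = (avgOp (fun g : S => (μ g).toReal) θ (fun g : S => (g : ℂ ≃ᵢ ℂ) 0) R ^ N) 1 x := by
  induction N generalizing x with
  | zero => simp [charFun_walkLaw_zero]
  | succ N ih =>
    have hR : ∀ z w : ℂ, inner ℝ z ((R : ℂ) * w) = R * inner ℝ z w := fun z w => by
      rw [← Complex.real_smul, real_inner_smul_right]
    rw [charFun_walkLaw_succ hS, pow_succ', Module.End.mul_apply, avgOp_apply]
    refine Finset.sum_congr rfl fun g _ => ?_
    congr 1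
    rw [← ih, charFun_apply, ← integral_const_mul]
    refine integral_congr_ae (.of_forall fun w => ?_)
    simp only
    rw [hθ g w, inner_add_left, add_comm, phase_add, hR, hR, hR, inner_mul_unitAt]
    rfl

end FiniteSupport

lemma exists_polar (ξ : ℂ) : ∃ (R : ℝ) (x : Ang), 0 ≤ R ∧ ξ = R * unitAt x :=
  ⟨‖ξ‖, (ξ.arg : Ang), norm_nonneg _, by rw [unitAt_coe, Complex.norm_mul_exp_arg_mul_I]⟩

/-! ### The scaled Gaussian -/

/-- The law of `s Z`, for `Z` a standard Gaussian on the plane. -/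
noncomputable def scaledGaussian (s : ℝ) : Measure ℂ := (stdGaussian ℂ).map fun z => s • z

instance isProbabilityMeasure_scaledGaussian (s : ℝ) : IsProbabilityMeasure (scaledGaussian s) :=
  Measure.isProbabilityMeasure_map (by fun_prop)

lemma isGaussian_scaledGaussian (s : ℝ) : IsGaussian (scaledGaussian s) := by
  have : (fun z : ℂ => s • z) = (s • ContinuousLinearMap.id ℝ ℂ : ℂ →L[ℝ] ℂ) := by ext z; simp
  rw [scaledGaussian, this]
  infer_instance

lemma charFun_scaledGaussian (s : ℝ) (t : ℂ) :
    charFun (scaledGaussian s) t = (Real.exp (-(s ^ 2 * ‖t‖ ^ 2 / 2)) : ℂ) := by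
  rw [scaledGaussian, charFun_map_smul, charFun_stdGaussian, norm_smul,
    ← Complex.ofReal_pow, mul_pow, Real.norm_eq_abs, sq_abs]
  push_cast
  congr 1
  ring

lemma stdGaussian_real_eq (s : ℝ) {B : Set ℂ} (hB : MeasurableSet B) :
    (stdGaussian ℂ).real {z | (s : ℂ) * z ∈ B} = (scaledGaussian s).real B := by
  rw [scaledGaussian, map_measureReal_apply (by fun_prop) hB]
  rfl

lemma scaledGaussian_le {s : ℝ} (hs : s ≠ 0) {A : Set ℂ} (hA : MeasurableSet A) :
    scaledGaussian s A ≤ ENNReal.ofReal (1 / s ^ 2) * volume A := by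
  rw [scaledGaussian, Measure.map_apply (by fun_prop) hA]
  refine (stdGaussian_complex_le_volume _).trans (le_of_eq ?_)
  rw [Measure.addHaar_preimage_smul _ hs, Complex.finrank_real_complex, abs_of_pos (by positivity),
    one_div]

/-! ### Verification of the hypotheses of the spectral gap -/

lemma Reach.nsmul {ι : Type*} {θ : ι → Ang} {b : ι → ℂ} (i : ι) {n : ℕ} {x : Ang} {t : ℂ}
    (h : Reach θ b n x t) (k : ℕ) :
    ∃ s, Reach θ b (n + k) (k • θ i + x) s := by
  induction k with
  | zero => exact ⟨t, by simpa using h⟩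
  | succ k ih =>
    obtain ⟨s, hs⟩ := ih
    refine ⟨b i + unitAt (θ i) * s, ?_⟩
    rw [succ_nsmul', add_assoc]
    exact hs.step i

section Walk

variable {ι : Type*} [Fintype ι] {p : ι → ℝ} {θ : ι → Ang} {b : ι → ℂ}

lemma unitAt_injective : Function.Injective unitAt := fun _ _ h =>
  AddCircle.injective_toCircle Real.two_pi_pos.ne' (Subtype.ext h)

lemma eq_one_of_sum_eq_one (hp : ∀ i, 0 < p i) (hp1 : ∑ i, p i = 1) {z : ι → ℂ}
    (hz : ∀ i, ‖z i‖ = 1) (h : ∑ i, (p i : ℂ) * z i = 1) (i : ι) : z i = 1 := by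
  have hre : ∀ i, (z i).re ≤ 1 := fun i => (Complex.re_le_norm _).trans (hz i).le
  have h1 : ∑ i, p i * (1 - (z i).re) = 0 := by
    have := congrArg Complex.re h
    simp only [Complex.re_sum, Complex.re_ofReal_mul, Complex.one_re] at this
    simp_rw [mul_sub, mul_one, Finset.sum_sub_distrib, this, hp1, sub_self]
  rw [Finset.sum_eq_zero_iff_of_nonneg fun i _ =>
    mul_nonneg (hp i).le (sub_nonneg.2 (hre i))] at h1
  have h2 : (z i).re = 1 := by
    rcases mul_eq_zero.1 (h1 i (Finset.mem_univ i)) with h | h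
    · exact absurd h (hp i).ne'
    · linarith
  have h3 : (z i).im = 0 := by
    have := Complex.normSq_eq_norm_sq (z i)
    rw [hz, Complex.normSq_apply, h2] at this
    nlinarith
  exact Complex.ext h2 h3

/-- If every i commutes with a fixed j having b_j ≠ 0, averaging over i with mean zero gives
E[e^{iθ}] b_j = b_j. Then E[e^{iθ}] = 1, and all rotations are trivial. -/
lemma exists_not_commute (hp : ∀ i, 0 < p i) (hp1 : ∑ i, p i = 1)
    (hmean : ∑ i, (p i : ℂ) * b i = 0) (hθ : ∃ i, unitAt (θ i) ≠ 1) (hb : ∃ i, b i ≠ 0) :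
    ∃ i₁ i₂, (b i₁ + unitAt (θ i₁) * b i₂) - (b i₂ + unitAt (θ i₂) * b i₁) ≠ 0 := by
  by_contra! h
  obtain ⟨j, hj⟩ := hb
  obtain ⟨i, hi⟩ := hθ
  refine hi (eq_one_of_sum_eq_one hp hp1 (fun i => norm_unitAt (θ i)) ?_ i)
  have h1 : ∑ i, (p i : ℂ) * ((b i + unitAt (θ i) * b j) - (b j + unitAt (θ j) * b i)) = 0 :=
    Finset.sum_eq_zero fun i _ => by rw [h i j, mul_zero]
  have h2 : ∑ i, (p i : ℂ) * ((b i + unitAt (θ i) * b j) - (b j + unitAt (θ j) * b i))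
      = (1 - unitAt (θ j)) * ∑ i, (p i : ℂ) * b i + (∑ i, (p i : ℂ) * unitAt (θ i)) * b j
        - (∑ i, (p i : ℂ)) * b j := by
    rw [Finset.mul_sum, Finset.sum_mul, Finset.sum_mul, ← Finset.sum_add_distrib,
      ← Finset.sum_sub_distrib]
    exact Finset.sum_congr rfl fun i _ => by ring
  rw [h2, hmean, ← Complex.ofReal_sum, hp1, Complex.ofReal_one, mul_zero, zero_add, ← sub_mul,
    mul_eq_zero] at h1
  rcases h1 with h1 | h1
  · exact sub_eq_zero.1 h1
  · exact absurd h1 hj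

lemma exists_gapData (hp : ∀ i, 0 < p i) (hp1 : ∑ i, p i = 1)
    (hmean : ∑ i, (p i : ℂ) * b i = 0) (hb : ∃ i, b i ≠ 0) {m : ℝ}
    (h : (∃ i j, ∃ α : ℝ, (α : Ang) = θ i - θ j ∧ DiophantineAngle m α) ∨
      ∃ α : ℝ, DiophantineAngle m α ∧ ∀ i, θ i = (α : Ang)) :
    (∃ (α : ℝ) (i₁ i₂ : ι) (M : ℕ), GapData p θ b α i₁ i₂ M) ∧
      ∑ i, (p i : ℂ) * unitAt (θ i) ^ 2 ≠ 1 := by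
  obtain ⟨α, hα, hreach, hsq⟩ : ∃ α : ℝ, DiophantineAngle m α ∧
      (∀ K : ℕ, ∃ γ : Ang, ∀ k ≤ K, ∃ n ≤ K, ∃ s, Reach θ b n (γ + k • (α : Ang)) s) ∧
      ((∀ i, unitAt (θ i) ^ 2 = 1) → unitAt (α : Ang) ^ 2 = 1) := by
    rcases h with ⟨i, j, α, hα, hD⟩ | ⟨α, hD, hα⟩
    · refine ⟨α, hD, fun K => ⟨K • θ j, fun k hk => ⟨K, le_rfl, ?_⟩⟩, fun h => ?_⟩
      · obtain ⟨s, hs⟩ := (Reach.zero (θ := θ) (b := b)).nsmul j (K - k)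
        obtain ⟨s', hs'⟩ := hs.nsmul i k
        refine ⟨s', ?_⟩
        convert hs' using 1
        · omega
        · obtain ⟨d, rfl⟩ := Nat.exists_eq_add_of_le hk
          rw [hα, Nat.add_sub_cancel_left, add_nsmul, nsmul_sub]
          abel
      · rw [hα, sub_eq_add_neg, unitAt_add, unitAt_neg, mul_pow, ← map_pow, h i, h j]
        simp
    · obtain ⟨i, -⟩ := hb
      refine ⟨α, hD, fun K => ⟨0, fun k hk => ⟨k, hk, ?_⟩⟩, fun h => by rw [← hα i]; exact h i⟩
      obtain ⟨s, hs⟩ := (Reach.zero (θ := θ) (b := b)).nsmul i k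
      refine ⟨s, ?_⟩
      rw [hα i, add_zero, zero_add] at hs
      rwa [zero_add]
  obtain ⟨c, hc, M, hM⟩ := hα.exists_lower_bound
  have hsq' : ∃ i, unitAt (θ i) ^ 2 ≠ 1 := by
    by_contra! hall
    have h2 := norm_pow_sub_one_pos_of_lower_bound hc hM two_pos
    rw [hsq hall] at h2
    simp at h2
  obtain ⟨i, hi⟩ := hsq'
  obtain ⟨i₁, i₂, hne⟩ := exists_not_commute hp hp1 hmean
    ⟨i, fun h => hi (by rw [h, one_pow])⟩ hb
  refine ⟨⟨α, i₁, i₂, M, hp, hp1, hreach, hne, c, hc, hM⟩, fun h1 => hi ?_⟩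
  exact eq_one_of_sum_eq_one hp hp1 (z := fun i => unitAt (θ i) ^ 2)
    (fun i => by rw [norm_pow, norm_unitAt, one_pow]) h1 i

end Walk

/-! ### The local limit theorem -/

/-- With y = N^{1/P} the threshold is e^{-(log N)²/(64P²)}. Half of this exponent is given to r, and
the other half absorbs √N and 2π. -/
lemma eventually_scale (P : ℕ) (hP : 0 < P) : ∀ᶠ N : ℕ in atTop, ∀ r : ℝ,
    Real.exp (-(1 / (128 * P ^ 2)) * Real.log N ^ 2) < r →
    Real.exp (-(Real.log ((N : ℝ) ^ ((P : ℝ)⁻¹)) ^ 2 / 64))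
      ≤ r / Real.sqrt N / (2 * Real.pi) := by
  have hP' : (0 : ℝ) < P := by exact_mod_cast hP
  have hlog : Tendsto (fun N : ℕ => Real.log N) atTop atTop :=
    Real.tendsto_log_atTop.comp tendsto_natCast_atTop_atTop
  filter_upwards [hlog.eventually_ge_atTop (128 * P ^ 2 * (1 / 2 + Real.log (2 * Real.pi)) + 1),
    eventually_ge_atTop 1] with N hN hN1 r hr
  have hN0 : (0 : ℝ) < N := by exact_mod_cast hN1
  have hp := Real.two_pi_pos
  have hl2 : 0 < Real.log (2 * Real.pi) := Real.log_pos (by linarith [Real.pi_gt_three])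
  set L := Real.log N with hL
  have hL1 : 1 ≤ L := by
    have : 0 ≤ 128 * (P : ℝ) ^ 2 * (1 / 2 + Real.log (2 * Real.pi)) := by positivity
    linarith
  rw [Real.log_rpow hN0, ← hL, le_div_iff₀ hp, le_div_iff₀ (Real.sqrt_pos.2 hN0)]
  refine le_trans ?_ hr.le
  have e1 : 2 * Real.pi = Real.exp (Real.log (2 * Real.pi)) := (Real.exp_log hp).symm
  have e2 : Real.sqrt N = Real.exp (L / 2) := by
    rw [← Real.exp_log (Real.sqrt_pos.2 hN0), Real.log_sqrt hN0.le]
  rw [e2]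
  nth_rewrite 1 [e1]
  rw [← Real.exp_add, ← Real.exp_add, Real.exp_le_exp]
  have key : Real.log (2 * Real.pi) + L / 2 ≤ 1 / (128 * P ^ 2) * L ^ 2 := by
    rw [one_div_mul_eq_div, le_div_iff₀ (by positivity)]
    have h1 : Real.log (2 * Real.pi) + L / 2 ≤ (1 / 2 + Real.log (2 * Real.pi)) * L := by
      nlinarith
    have h2 : 128 * (P : ℝ) ^ 2 * (1 / 2 + Real.log (2 * Real.pi)) ≤ L := by linarith
    calc (Real.log (2 * Real.pi) + L / 2) * (128 * P ^ 2)
        ≤ (1 / 2 + Real.log (2 * Real.pi)) * L * (128 * P ^ 2) := by gcongr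
      _ = 128 * P ^ 2 * (1 / 2 + Real.log (2 * Real.pi)) * L := by ring
      _ ≤ L * L := by gcongr
      _ = L ^ 2 := by ring
  have e3 : ((P : ℝ)⁻¹ * L) ^ 2 / 64 = 2 * (1 / (128 * P ^ 2) * L ^ 2) := by
    field_simp
    ring
  rw [e3]
  linarith

lemma rpow_neg_three_halves {N : ℝ} (hN : 0 < N) :
    N ^ (-(3 / 2) : ℝ) = 1 / (N * Real.sqrt N) := by
  rw [Real.rpow_neg hN.le, Real.sqrt_eq_rpow, show (3 / 2 : ℝ) = 1 + 1 / 2 by norm_num,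
    Real.rpow_add hN, Real.rpow_one, one_div (N * _)]

/-- An inequality that holds for large `N` holds for all `N` with a larger constant. -/
lemma exists_const_of_eventually {c : ℝ} (hc : 0 < c) {d : ℕ → ℂ → ℝ → ℝ} (hd : ∀ N x r, d N x r ≤ 1)
    {C : ℝ} (hC : 0 < C)
    (h : ∀ᶠ N : ℕ in atTop, ∀ (x : ℂ) (r : ℝ), Real.exp (-c * Real.log N ^ 2) < r →
      d N x r ≤ C * (N : ℝ) ^ (-(3 / 2) : ℝ) * r ^ 2) :
    ∃ C : ℝ, 0 < C ∧ ∀ N : ℕ, 1 ≤ N → ∀ (x : ℂ) (r : ℝ), Real.exp (-c * Real.log N ^ 2) < r →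
      d N x r ≤ C * (N : ℝ) ^ (-(3 / 2) : ℝ) * r ^ 2 := by
  obtain ⟨N₀, hN₀⟩ := eventually_atTop.1 h
  -- Chosen so that the right-hand side is at least 1 for N < N₀, where r² > e^{-2c (log(N₀ + 1))²}.
  set C' := ((N₀ : ℝ) + 1) ^ (3 / 2 : ℝ) * Real.exp (2 * c * Real.log (N₀ + 1) ^ 2)
  refine ⟨C + C', by positivity, fun N hN x r hr => ?_⟩
  have hN' : (1 : ℝ) ≤ N := by exact_mod_cast hN
  have hr0 : 0 < r := (Real.exp_pos _).trans hr
  have hmono : ∀ K ≤ C + C', K * (N : ℝ) ^ (-(3 / 2) : ℝ) * r ^ 2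
      ≤ (C + C') * (N : ℝ) ^ (-(3 / 2) : ℝ) * r ^ 2 := fun K hK => by gcongr
  by_cases hNN : N₀ ≤ N
  · exact (hN₀ N hNN x r hr).trans (hmono C (le_add_of_nonneg_right (by positivity)))
  · have hNN' : (N : ℝ) ≤ N₀ + 1 := by
      have : N ≤ N₀ + 1 := by omega
      exact_mod_cast this
    refine (hd N x r).trans (le_trans ?_ (hmono C' (le_add_of_nonneg_left hC.le)))
    have h1 : (1 : ℝ) ≤ ((N₀ : ℝ) + 1) ^ (3 / 2 : ℝ) * (N : ℝ) ^ (-(3 / 2) : ℝ) := by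
      rw [Real.rpow_neg (by linarith), ← div_eq_mul_inv, one_le_div (by positivity)]
      exact Real.rpow_le_rpow (by linarith) hNN' (by norm_num)
    have h2 : (1 : ℝ) ≤ Real.exp (2 * c * Real.log (N₀ + 1) ^ 2) * r ^ 2 := by
      have h3 : Real.exp (-c * Real.log N ^ 2) ^ 2 ≤ r ^ 2 := by gcongr
      refine le_trans ?_ (mul_le_mul_of_nonneg_left h3 (Real.exp_pos _).le)
      rw [← Real.exp_nat_mul, ← Real.exp_add]
      refine Real.one_le_exp ?_
      have h4 : Real.log N ≤ Real.log (N₀ + 1) := Real.log_le_log (by linarith) hNN'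
      have h5 : Real.log N ^ 2 ≤ Real.log (N₀ + 1) ^ 2 :=
        pow_le_pow_left₀ (Real.log_nonneg hN') h4 2
      push_cast
      nlinarith
    calc (1 : ℝ) = 1 * 1 := (one_mul 1).symm
      _ ≤ (((N₀ : ℝ) + 1) ^ (3 / 2 : ℝ) * (N : ℝ) ^ (-(3 / 2) : ℝ))
          * (Real.exp (2 * c * Real.log (N₀ + 1) ^ 2) * r ^ 2) :=
        mul_le_mul h1 h2 zero_le_one (by positivity)
      _ = _ := by ring

lemma abs_measureReal_sub_le_one (μ ν : Measure ℂ) [IsProbabilityMeasure μ]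
    [IsProbabilityMeasure ν] (B : Set ℂ) : |μ.real B - ν.real B| ≤ 1 := by
  have h1 : μ.real B ≤ 1 := measureReal_le_one
  have h2 : ν.real B ≤ 1 := measureReal_le_one
  have h3 : 0 ≤ μ.real B := measureReal_nonneg
  have h4 : 0 ≤ ν.real B := measureReal_nonneg
  rw [abs_le]
  constructor <;> linarith

section FiniteSupport

variable {μ : PMF (ℂ ≃ᵢ ℂ)} {S : Finset (ℂ ≃ᵢ ℂ)}

lemma walkSigma_sq (hS : ∀ g, g ∉ S → μ g = 0) :
    walkSigma μ ^ 2 = 1 / 2 * ∑ g : S, (μ g).toReal * ‖(g : ℂ ≃ᵢ ℂ) 0‖ ^ 2 := by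
  rw [walkSigma, integral_toMeasure_eq_sum hS, Real.sq_sqrt]
  · simp
  · exact mul_nonneg (by norm_num) (Finset.sum_nonneg fun g _ => by positivity)

lemma walkLaw_eq_scaledGaussian_zero (hS : ∀ g, g ∉ S → μ g = 0) {θ : S → Ang}
    (hθ : ∀ (g : S) (x : ℂ), (g : ℂ ≃ᵢ ℂ) x = unitAt (θ g) * x + (g : ℂ ≃ᵢ ℂ) 0)
    (hb : ∀ g : S, (g : ℂ ≃ᵢ ℂ) 0 = 0) (N : ℕ) : walkLaw μ N = scaledGaussian 0 := by
  refine Measure.ext_of_charFun (funext fun ξ => ?_)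
  obtain ⟨R, x, -, rfl⟩ := exists_polar ξ
  rw [charFun_walkLaw hS hθ, charFun_scaledGaussian]
  have h1 : ∀ N : ℕ,
      (avgOp (fun g : S => (μ g).toReal) θ (fun g : S => (g : ℂ ≃ᵢ ℂ) 0) R ^ N) 1 = 1 := by
    intro N
    induction N with
    | zero => simp
    | succ N ih =>
      rw [pow_succ', Module.End.mul_apply, ih]
      ext x
      rw [avgOp_apply]
      simp only [hb, inner_zero_left, mul_zero, phase_zero, ContinuousMap.one_apply, mul_one]
      rw [← Complex.ofReal_sum, sum_toReal_eq_one hS, Complex.ofReal_one]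
  rw [h1]
  simp

lemma exists_local_limit_bound (hS : ∀ g, g ∉ S → μ g = 0) (hS' : ∀ g ∈ S, 0 < (μ g).toReal)
    {θ : S → Ang}
    (hθ : ∀ (g : S) (x : ℂ), (g : ℂ ≃ᵢ ℂ) x = unitAt (θ g) * x + (g : ℂ ≃ᵢ ℂ) 0)
    (hmean : ∑ g : S, ((μ g).toReal : ℂ) * (g : ℂ ≃ᵢ ℂ) 0 = 0) {m : ℝ}
    (h : (∃ i j, ∃ α : ℝ, (α : Ang) = θ i - θ j ∧ DiophantineAngle m α) ∨
      ∃ α : ℝ, DiophantineAngle m α ∧ ∀ i, θ i = (α : Ang)) :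
    ∃ c : ℝ, 0 < c ∧ ∃ C : ℝ, 0 < C ∧ ∀ N : ℕ, 1 ≤ N → ∀ (x₀ : ℂ) (r : ℝ),
      Real.exp (-c * Real.log N ^ 2) < r →
      |(walkLaw μ N).real (Metric.ball x₀ r)
          - (scaledGaussian (walkSigma μ * Real.sqrt N)).real (Metric.ball x₀ r)|
        ≤ C * (N : ℝ) ^ (-(3 / 2) : ℝ) * r ^ 2 := by
  have hp1 := sum_toReal_eq_one hS
  have hp : ∀ g : S, 0 < (μ g).toReal := fun g => hS' g g.2
  have hσ := walkSigma_sq hS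
  by_cases hb : ∃ g : S, (g : ℂ ≃ᵢ ℂ) 0 ≠ 0
  swap
  -- If all translation parts vanish, the walk stays at 0 and equals its degenerate Gaussian.
  · push Not at hb
    refine ⟨1, one_pos, 1, one_pos, fun N hN x₀ r hr => ?_⟩
    have h0 : walkSigma μ = 0 := by
      rw [← sq_eq_zero_iff, hσ]
      simp [hb]
    rw [walkLaw_eq_scaledGaussian_zero hS hθ hb, h0, zero_mul, sub_self, abs_zero]
    positivity
  obtain ⟨⟨α, i₁, i₂, M, hgap⟩, hlam⟩ := exists_gapData hp hp1 hmean hb h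
  have hv0 : 0 < walkSigma μ ^ 2 := by
    obtain ⟨g, hg⟩ := hb
    rw [hσ]
    refine mul_pos (by norm_num) (Finset.sum_pos' (fun i _ => by positivity)
      ⟨g, Finset.mem_univ _, ?_⟩)
    have := hp g
    have := norm_pos_iff.2 hg
    positivity
  obtain ⟨C₁, hC₁, y₀, hrad⟩ := hgap.exists_radial_bound hmean hσ hv0 hlam
  obtain ⟨C₂, hC₂, hsm⟩ := exists_smoothing
  set v := walkSigma μ ^ 2 with hv
  set P := 8 * M + 32 with hP
  have hP0 : 0 < P := by omega
  have hP0' : (0 : ℝ) < P := by exact_mod_cast hP0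
  refine ⟨1 / (128 * P ^ 2), by positivity, ?_⟩
  refine exists_const_of_eventually (c := 1 / (128 * (P : ℝ) ^ 2)) (by positivity)
    (d := fun N x₀ r => |(walkLaw μ N).real (Metric.ball x₀ r)
      - (scaledGaussian (walkSigma μ * Real.sqrt N)).real (Metric.ball x₀ r)|)
    (fun N x r => abs_measureReal_sub_le_one _ _ _)
    (C := C₂ * (1 / v + Real.sqrt (2 * Real.pi) * C₁ * Real.pi))
    (by have := Real.pi_pos; positivity) ?_
  have hy : Tendsto (fun N : ℕ => (N : ℝ) ^ ((P : ℝ)⁻¹)) atTop atTop :=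
    (tendsto_rpow_atTop (inv_pos.2 hP0')).comp tendsto_natCast_atTop_atTop
  filter_upwards [eventually_scale P hP0, hy.eventually_ge_atTop y₀, eventually_ge_atTop 4]
    with N hscale hNy hN4 x₀ r hr
  have hN4' : (4 : ℝ) ≤ N := by exact_mod_cast hN4
  have hN0 : (0 : ℝ) < N := by linarith
  have hsq : 0 < Real.sqrt N := Real.sqrt_pos.2 hN0
  have hr0 : 0 < r := (Real.exp_pos _).trans hr
  -- The Gaussian has density at most 1/(vN), so this width makes the smoothing error of order r²/(v
  -- N^{3/2}), matching the Fourier error.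
  set δ := r / Real.sqrt N with hδ
  have hδ0 : 0 < δ := by positivity
  have hδr : 2 * δ ≤ r := by
    have h2 : 2 ≤ Real.sqrt N := Real.le_sqrt_of_sq_le (by norm_num; exact hN4)
    rw [hδ, mul_div_assoc', div_le_iff₀ hsq]
    nlinarith
  have hs0 : walkSigma μ * Real.sqrt N ≠ 0 :=
    mul_ne_zero (fun h0 => by rw [hv, h0] at hv0; norm_num at hv0) hsq.ne'
  have hs2 : (walkSigma μ * Real.sqrt N) ^ 2 = v * N := by
    rw [mul_pow, Real.sq_sqrt hN0.le]
  have hyN : (N : ℝ) = ((N : ℝ) ^ ((P : ℝ)⁻¹)) ^ P := by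
    rw [Real.rpow_inv_natCast_pow hN0.le hP0.ne']
  have hpi := Real.two_pi_pos
  have hJ := integral_le_of_radial_bound
    (φ := fun z => charFun (walkLaw μ N) z
      - charFun (scaledGaussian (walkSigma μ * Real.sqrt N)) z)
    (continuous_charFun.sub continuous_charFun)
    (F := fun R => (avgOp (fun g : S => (μ g).toReal) θ (fun g : S => (g : ℂ ≃ᵢ ℂ) 0) R ^ N) 1
      - (Real.exp (-(v * N * R ^ 2 / 2)) : ℂ) • 1)
    (fun R hR x => by
      rw [charFun_walkLaw hS hθ, charFun_scaledGaussian, hs2, norm_mul, norm_unitAt,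
        Complex.norm_real, Real.norm_eq_abs, mul_one, sq_abs]
      simp)
    hC₁.le hN0 (δ := δ / (2 * Real.pi)) (by positivity)
    (hrad _ hNy N hyN _ (hscale r hr))
  have hfin := hsm (walkLaw μ N) (scaledGaussian (walkSigma μ * Real.sqrt N)) (1 / (v * N))
    (by positivity) (fun A hA => by rw [← hs2]; exact scaledGaussian_le hs0 hA) x₀ r δ hδ0 hδr
  refine hfin.trans ?_
  rw [rpow_neg_three_halves hN0]
  calc C₂ * (1 / (v * N) * (r * δ) + r ^ 2 * _)
      ≤ C₂ * (1 / (v * N) * (r * δ) + r ^ 2 *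
        (Real.sqrt (2 * Real.pi) * C₁ * Real.pi / (N * Real.sqrt N))) := by gcongr
    _ = _ := by rw [hδ]; field_simp

end FiniteSupport

theorem theorem1 (μ : PMF (ℂ ≃ᵢ ℂ)) (hfin : μ.support.Finite)
    (hrot : ∀ g ∈ μ.support, ∃ θ : ℝ, HasRotationAngle g θ)
    (hmean : ∫ g, g 0 ∂μ.toMeasure = 0)
    (m : ℝ) (hm : 0 < m)
    (hdioph :
      (∃ g₁ ∈ μ.support, ∃ g₂ ∈ μ.support, ∃ θ : ℝ,
        HasRotationAngle (g₁ * g₂⁻¹) θ ∧ DiophantineAngle m θ) ∨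
      (∃ θ₀ : ℝ, DiophantineAngle m θ₀ ∧ ∀ g ∈ μ.support, HasRotationAngle g θ₀)) :
    ∃ c : ℝ, 0 < c ∧
      LocalCLTToScale μ (fun N => Real.exp (-c * Real.log N ^ 2)) ∧
      ∃ C : ℝ, 0 < C ∧ ∀ N : ℕ, 1 ≤ N → ∀ (x₀ : ℂ) (r : ℝ),
        Real.exp (-c * Real.log N ^ 2) < r →
        |walkProb μ N (Metric.ball x₀ r)
            - (stdGaussian ℂ).real {z | ((walkSigma μ * Real.sqrt N : ℝ) : ℂ) * z
                ∈ Metric.ball x₀ r}|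
          ≤ C * (N : ℝ) ^ (-(3 / 2) : ℝ) * r ^ 2 := by
  classical
  set S := hfin.toFinset with hSdef
  have hmem : ∀ g, g ∈ S ↔ g ∈ μ.support := fun g => hfin.mem_toFinset
  have hS : ∀ g, g ∉ S → μ g = 0 := fun g hg => by
    rwa [hmem, PMF.mem_support_iff, not_not] at hg
  have hS' : ∀ g ∈ S, 0 < (μ g).toReal := fun g hg =>
    ENNReal.toReal_pos ((PMF.mem_support_iff _ _).1 ((hmem g).1 hg)) (μ.apply_ne_top g)
  choose ang hang using fun g : S => hrot g ((hmem g).1 g.2)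
  set θ : S → Ang := fun g => (ang g : Ang) with hθdef
  have hθ : ∀ (g : S) (x : ℂ), (g : ℂ ≃ᵢ ℂ) x = unitAt (θ g) * x + (g : ℂ ≃ᵢ ℂ) 0 := by
    intro g x
    rw [hθdef, unitAt_coe]
    exact hang g x
  have hmean' : ∑ g : S, ((μ g).toReal : ℂ) * (g : ℂ ≃ᵢ ℂ) 0 = 0 := by
    rw [integral_toMeasure_eq_sum hS] at hmean
    simpa [Complex.real_smul] using hmean
  -- The rotation angle is determined modulo 2π by the value at 1, so the angles in the Diophantine
  -- hypotheses agree with the chosen ones.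
  have hang_eq : ∀ (g : ℂ ≃ᵢ ℂ) (φ : Ang) (ψ : ℝ), (∀ x, g x = unitAt φ * x + g 0) →
      HasRotationAngle g ψ → φ = (ψ : Ang) := by
    intro g φ ψ h1 h2
    refine unitAt_injective ?_
    have e1 := h1 1
    rw [h2 1, ← unitAt_coe] at e1
    simpa using e1.symm
  have hd : (∃ i j, ∃ α : ℝ, (α : Ang) = θ i - θ j ∧ DiophantineAngle m α) ∨
      ∃ α : ℝ, DiophantineAngle m α ∧ ∀ i, θ i = (α : Ang) := by
    rcases hdioph with ⟨g₁, h₁, g₂, h₂, α, hα, hD⟩ | ⟨α, hD, hα⟩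
    · refine Or.inl ⟨⟨g₁, (hmem _).2 h₁⟩, ⟨g₂, (hmem _).2 h₂⟩, α, ?_, hD⟩
      refine (hang_eq _ _ _ (fun x => ?_) hα).symm
      set i₁ : S := ⟨g₁, (hmem _).2 h₁⟩
      set i₂ : S := ⟨g₂, (hmem _).2 h₂⟩
      have hinv : ∀ x, g₂⁻¹ x = unitAt (-θ i₂) * (x - g₂ 0) := by
        intro x
        have hx : g₂ (g₂⁻¹ x) = x := by
          rw [← IsometryEquiv.mul_apply, mul_inv_cancel]; rfl
        have h3 := hθ i₂ (g₂⁻¹ x)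
        change g₂ (g₂⁻¹ x) = _ * _ + g₂ 0 at h3
        rw [hx] at h3
        have h4 : x - g₂ 0 = unitAt (θ i₂) * g₂⁻¹ x := sub_eq_iff_eq_add.2 h3
        rw [h4, ← mul_assoc, ← unitAt_add, neg_add_cancel, unitAt_zero, one_mul]
      have h1 : ∀ x, g₁ x = unitAt (θ i₁) * x + g₁ 0 := hθ i₁
      rw [IsometryEquiv.mul_apply, IsometryEquiv.mul_apply, h1, h1 (g₂⁻¹ 0), hinv, hinv 0,
        sub_eq_add_neg (θ i₁), unitAt_add]
      ring
    · exact Or.inr ⟨α, hD, fun i => hang_eq i _ _ (hθ i) (hα i ((hmem i).1 i.2))⟩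
  obtain ⟨c, hc, C, hC, hbound⟩ := exists_local_limit_bound hS hS' hθ hmean' hd
  refine ⟨c, hc, ⟨fun N => scaledGaussian (walkSigma μ * Real.sqrt N),
    fun N => isGaussian_scaledGaussian _, fun ε hε => ?_⟩, C, hC, fun N hN x₀ r hr => ?_⟩
  · have hsq : Tendsto (fun N : ℕ => Real.sqrt N) atTop atTop :=
      Real.tendsto_sqrt_atTop.comp tendsto_natCast_atTop_atTop
    filter_upwards [hsq.eventually_ge_atTop (C / ε), eventually_ge_atTop 1] with N hN hN1 x₀ r hr
    have hN0 : (0 : ℝ) < N := by exact_mod_cast hN1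
    have hs0 := Real.sqrt_pos.2 hN0
    rw [walkProb_eq μ N measurableSet_ball]
    refine (hbound N hN1 x₀ r hr).trans ?_
    rw [rpow_neg_three_halves hN0, ← mul_assoc]
    refine mul_le_mul_of_nonneg_right ?_ (sq_nonneg r)
    rw [mul_one_div, ← div_eq_mul_inv, div_le_div_iff₀ (by positivity) hN0]
    rw [div_le_iff₀ hε] at hN
    nlinarith
  · rw [walkProb_eq μ N measurableSet_ball, stdGaussian_real_eq _ measurableSet_ball]
    exact hbound N hN x₀ r hr
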